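/- Let $d\ge 1$ and $N\ge 0$ be integers, and let $P^N$ be the space of real polynomials in $d$ variables of total degree at most $N$. Let $D\subset\mathbb R^d$ be a (non-degenerate) $d$-simplex with faces $f_0,\dots,f_d$ and outward unit normal $\boldsymbol n$. Let $\beta$ be a real flux parameter that has a constant value $\beta_i$ on each face $f_i$. For $u\in P^N$ and exterior values $u^+$ on $\partial D$, given on each face $f_i$ by the restriction of a polynomial $u_i^+\in P^N$, let $[\![u]\!]=u^+-u$. The local LDG gradient of $u$ is the $\boldsymbol\theta\in (P^N)^d$ with $$(\boldsymbol\theta,\boldsymbol w)_{D}=(\nabla u,\boldsymbol w)_{D}+\left\langle \tfrac12 [\![u]\!](1-\beta),\ \boldsymbol w\cdot\boldsymbol n\right\rangle_{\partial D}\qquad\text{for all }\boldsymbol w\in (P^N)^d,$$ where $(\cdot,\cdot)_D$ and $\langle\cdot,\cdot\rangle_{\partial D}$ are the $L^2$ inner products on $D$ and on $\partial D$. Then: 1. $\boldsymbol\theta$ exists and is unique. 2. For every $\kappa$ there is a constant $C>0$ that depends only on $d$, $N$ and $\kappa$ such that, for every $d$-simplex $D$ whose diameter is at most $\kappa$ times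 its inradius (so $C$ does not depend on the size $h$ of $D$), every $\beta$ with $\beta_i=1$ for at least one $i$, and all $u$ and $u^+$ as above, $$\|\nabla u\|_{L^2(D)}\le C\,\|\boldsymbol\theta\|_{L^2(D)} .$$ 3. Consequently the null space of the LDG gradient consists only of constants: if $\beta_i=1$ for at least one $i$, then $\boldsymbol\theta=0$ if and only if $u$ is equal to a constant $c$ and $u^+=c$ on every face $f_i$ with $\beta_i\neq 1$. 4. In contrast, for the BR-1 gradient, which is the case $\beta=0$ on all faces: for every $N\ge 1$ and every $d$-simplex $D$ there are a non-constant $u\in P^N$ and exterior values $u^+$ as above with $\boldsymbol\theta=0$. -/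

import Mathlib

open MeasureTheory

noncomputable section

namespace LDG

/-- The value of a polynomial in `d` variables at a point of `ℝᵈ`. -/
def val {d : ℕ} (p : MvPolynomial (Fin d) ℝ) (x : EuclideanSpace ℝ (Fin d)) : ℝ :=
  MvPolynomial.eval (fun i => x i) p

/-- `Pᴺ`: the polynomials in `d` variables of total degree at most `N`. -/
abbrev P (d N : ℕ) : Submodule ℝ (MvPolynomial (Fin d) ℝ) :=
  MvPolynomial.restrictTotalDegree (Fin d) ℝ N

/-- The gradient of a polynomial, as a vector of polynomials. -/
def grad {d : ℕ} (u : MvPolynomial (Fin d) ℝ) : Fin d → MvPolynomial (Fin d) ℝ :=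
  fun j => MvPolynomial.pderiv j u

/-- The (closed) affine simplex spanned by the vertices of `s`. -/
def cell {d : ℕ} (s : Affine.Simplex ℝ (EuclideanSpace ℝ (Fin d)) d) :
    Set (EuclideanSpace ℝ (Fin d)) :=
  convexHull ℝ (Set.range s.points)

/-- The face of the simplex opposite to the vertex `i`. -/
def face {d : ℕ} (s : Affine.Simplex ℝ (EuclideanSpace ℝ (Fin d)) d) (i : Fin (d + 1)) :
    Set (EuclideanSpace ℝ (Fin d)) :=
  convexHull ℝ (s.points '' {i}ᶜ)

/-- The outward unit normal on the face opposite to the vertex `i`: it points from that vertex to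
its orthogonal projection on the hyperplane of the face. -/
def normal {d : ℕ} [NeZero d] (s : Affine.Simplex ℝ (EuclideanSpace ℝ (Fin d)) d)
    (i : Fin (d + 1)) : EuclideanSpace ℝ (Fin d) :=
  (s.height i)⁻¹ • (s.altitudeFoot i -ᵥ s.points i)

/-- The `L²` inner product over the simplex of two vectors of polynomials. -/
def innerCell {d : ℕ} (s : Affine.Simplex ℝ (EuclideanSpace ℝ (Fin d)) d)
    (v w : Fin d → MvPolynomial (Fin d) ℝ) : ℝ :=
  ∫ x in cell s, ∑ j, val (v j) x * val (w j) x

/-- The `L²` norm over the simplex of a vector of polynomials. -/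
def normCell {d : ℕ} (s : Affine.Simplex ℝ (EuclideanSpace ℝ (Fin d)) d)
    (v : Fin d → MvPolynomial (Fin d) ℝ) : ℝ :=
  Real.sqrt (innerCell s v v)

/-- The surface term `⟨(1/2) ⟦u⟧ (1 - β), w ⬝ n⟩` on the boundary of the simplex. On the face
opposite to the vertex `i`, the flux parameter has the constant value `β i`, the exterior value of
the solution is the polynomial `uExt i`, and the jump is `⟦u⟧ = uExt i - u`. Faces carry the
`(d-1)`-dimensional surface measure. -/
def boundaryTerm {d : ℕ} [NeZero d] (s : Affine.Simplex ℝ (EuclideanSpace ℝ (Fin d)) d)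
    (β : Fin (d + 1) → ℝ) (u : MvPolynomial (Fin d) ℝ)
    (uExt : Fin (d + 1) → MvPolynomial (Fin d) ℝ) (w : Fin d → MvPolynomial (Fin d) ℝ) : ℝ :=
  ∑ i, ∫ x in face s i,
    (1 / 2 * (val (uExt i) x - val u x) * (1 - β i)) * (∑ j, val (w j) x * normal s i j)
      ∂(Measure.euclideanHausdorffMeasure (d - 1))

/-- `θ` is the local LDG gradient of degree `N` of `u` on the simplex, for the flux parameters `β`
and the exterior values `uExt`. -/
structure IsLDGGradient {d : ℕ} [NeZero d] (N : ℕ)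
    (s : Affine.Simplex ℝ (EuclideanSpace ℝ (Fin d)) d) (β : Fin (d + 1) → ℝ)
    (u : MvPolynomial (Fin d) ℝ) (uExt : Fin (d + 1) → MvPolynomial (Fin d) ℝ)
    (θ : Fin d → MvPolynomial (Fin d) ℝ) : Prop where
  mem : ∀ j, θ j ∈ P d N
  eq : ∀ w : Fin d → MvPolynomial (Fin d) ℝ, (∀ j, w j ∈ P d N) →
    innerCell s θ w = innerCell s (grad u) w + boundaryTerm s β u uExt w

/-- Shape regularity with constant `κ`: the diameter of the simplex is at most `κ` times the radius
of its inscribed ball. -/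
def ShapeRegular {d : ℕ} [NeZero d] (κ : ℝ)
    (s : Affine.Simplex ℝ (EuclideanSpace ℝ (Fin d)) d) : Prop :=
  Metric.diam (cell s) ≤ κ * s.inradius

end LDG

end

/-!
The first claim is the Riesz representation theorem on the finite-dimensional space of fields with
components in `Pᴺ`, because the surface term is linear in the test field.

For the estimate, let `β = 1` on the face opposite to the vertex `v₀`, let `e j` be the edges at
`v₀`, and let `λ j` be the barycentric coordinates of their far ends. The test field
`w = ∑ j, λ j (e j ⬝ ∇u) e j` lies in `(Pᴺ)ᵈ`, and `w ⬝ n` vanishes on all faces through `v₀`: on the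
face opposite to the far end of `e j`, all the other edges are tangential and `λ j` is zero. So the
surface term drops out, and `(θ, w) = ∑ j, ∫ λ j (e j ⬝ ∇u)²`. The weights `λ j` may be removed at
the cost of a constant, which does not depend on the simplex since all simplices are affinely
equivalent (`exists_cellInt_le`), and `∑ j, (e j ⬝ g)² ≥ r² |g|²` for the inradius `r`
(`inradius_mul_norm_sq_le`). As the edges are no longer than the diameter, which is at most `κ r`,
the Cauchy–Schwarz inequality gives the estimate (`exists_normCell_grad_le`).

If `θ = 0`, then the estimate, applied with the shape constant of the simplex at hand, shows that
`u` is a constant `c`. Testing with `(uExt i - c) e j`, where `e j` is the one edge at `v₀` that is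
not tangential to the face `i`, gives `uExt i = c` on each face with `β i ≠ 1`
(`isLDGGradient_zero_iff`).

For `β = 0`, take a non-constant `u` in `Pᴺ` that is orthogonal to all polynomials of lower degree.
If the normal component of a field `w` in `(Pᴺ)ᵈ` vanishes on the boundary, then integration by parts
gives `(∇u, w) = -(u, div w) = 0` (`innerCell_grad_eq_zero`). By duality in finite dimension,
`w ↦ (∇u, w)` is a functional of the normal components on the faces
(`exists_face_representation`), and the exterior values can be chosen to cancel it. The integration
by parts involves no surface integral, so it follows from the case of compact support by cutting off
with a function of the product of the barycentric coordinates (`cellInt_div_eq_zero`).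
-/

namespace LDG

/-! ### Polynomials as functions -/

section Polynomials

variable {d : ℕ}

@[simp] lemma val_add (p q : MvPolynomial (Fin d) ℝ) (x : EuclideanSpace ℝ (Fin d)) :
    val (p + q) x = val p x + val q x := by simp [val]

@[simp] lemma val_sub (p q : MvPolynomial (Fin d) ℝ) (x : EuclideanSpace ℝ (Fin d)) :
    val (p - q) x = val p x - val q x := by simp [val]

@[simp] lemma val_mul (p q : MvPolynomial (Fin d) ℝ) (x : EuclideanSpace ℝ (Fin d)) :
    val (p * q) x = val p x * val q x := by simp [val]

@[simp] lemma val_pow (p : MvPolynomial (Fin d) ℝ) (n : ℕ) (x : EuclideanSpace ℝ (Fin d)) :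
    val (p ^ n) x = val p x ^ n := by simp [val]

@[simp] lemma val_smul (c : ℝ) (p : MvPolynomial (Fin d) ℝ) (x : EuclideanSpace ℝ (Fin d)) :
    val (c • p) x = c * val p x := by simp [val, MvPolynomial.smul_eval]

@[simp] lemma val_C (c : ℝ) (x : EuclideanSpace ℝ (Fin d)) :
    val (MvPolynomial.C c : MvPolynomial (Fin d) ℝ) x = c := by simp [val]

@[simp] lemma val_X (j : Fin d) (x : EuclideanSpace ℝ (Fin d)) :
    val (MvPolynomial.X j : MvPolynomial (Fin d) ℝ) x = x j := by simp [val]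

@[simp] lemma val_zero (x : EuclideanSpace ℝ (Fin d)) :
    val (0 : MvPolynomial (Fin d) ℝ) x = 0 := by simp [val]

@[simp] lemma val_sum {ι : Type*} (t : Finset ι) (p : ι → MvPolynomial (Fin d) ℝ)
    (x : EuclideanSpace ℝ (Fin d)) : val (∑ i ∈ t, p i) x = ∑ i ∈ t, val (p i) x := by simp [val]

lemma hasFDerivAt_val (p : MvPolynomial (Fin d) ℝ) (x : EuclideanSpace ℝ (Fin d)) :
    HasFDerivAt (val p)
      (∑ j, val (MvPolynomial.pderiv j p) x • (EuclideanSpace.proj j : _ →L[ℝ] ℝ)) x := by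
  induction p using MvPolynomial.induction_on with
  | C a =>
    have h : val (MvPolynomial.C a : MvPolynomial (Fin d) ℝ) = fun _ => a := by ext; simp
    rw [h]
    simpa using hasFDerivAt_const a x
  | add p q hp hq =>
    have h : val (p + q) = fun x => val p x + val q x := by ext; simp
    rw [h]
    exact (hp.add hq).congr_fderiv (by simp [add_smul, Finset.sum_add_distrib])
  | mul_X p i hp =>
    have h : val (p * MvPolynomial.X i) = fun x => val p x * x i := by ext; simp
    rw [h]
    have h2 : HasFDerivAt (fun x : EuclideanSpace ℝ (Fin d) => x i)
      (EuclideanSpace.proj i : _ →L[ℝ] ℝ) x := (EuclideanSpace.proj i : _ →L[ℝ] ℝ).hasFDerivAt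
    refine (hp.mul h2).congr_fderiv (Eq.symm ?_)
    simp only [Derivation.leibniz, MvPolynomial.pderiv_X, smul_eq_mul, val_add, val_mul, val_X,
      add_smul, Finset.sum_add_distrib, Finset.smul_sum, mul_smul]
    congr 1
    · rw [Finset.sum_eq_single i]
      · simp [val]
      · intro j _ hj
        rw [Pi.single_eq_of_ne hj.symm]; simp
      · simp

@[fun_prop] lemma continuous_val (p : MvPolynomial (Fin d) ℝ) : Continuous (val p) :=
  continuous_iff_continuousAt.2 fun x => (hasFDerivAt_val p x).continuousAt

/-- A polynomial that vanishes on a nonempty open set is zero. -/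
lemma eq_zero_of_val_eq_zero {p : MvPolynomial (Fin d) ℝ} {U : Set (EuclideanSpace ℝ (Fin d))}
    (hU : IsOpen U) (hne : U.Nonempty) (h : ∀ x ∈ U, val p x = 0) : p = 0 := by
  obtain ⟨x₀, hx₀⟩ := hne
  have hV : IsOpen ((WithLp.toLp 2 : (Fin d → ℝ) → EuclideanSpace ℝ (Fin d)) ⁻¹' U) :=
    hU.preimage (PiLp.continuous_toLp 2 _)
  obtain ⟨ε, hε, hball⟩ := Metric.isOpen_iff.1 hV (x₀ : Fin d → ℝ) hx₀
  refine MvPolynomial.funext_set (fun i => Metric.ball (x₀ i) ε) (fun i => ?_) fun x hx => ?_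
  · rw [Real.ball_eq_Ioo]
    exact Set.Ioo_infinite (by linarith)
  · have hxU := hball (show x ∈ Metric.ball (x₀ : Fin d → ℝ) ε from by
      rw [ball_pi _ hε]; exact hx)
    simpa [val] using h _ hxU

lemma P_mono {N M : ℕ} (h : N ≤ M) : P d N ≤ P d M := fun p hp => by
  rw [MvPolynomial.mem_restrictTotalDegree] at *; omega

lemma C_mem_P (N : ℕ) (c : ℝ) : MvPolynomial.C c ∈ P d N := by
  rw [MvPolynomial.mem_restrictTotalDegree]; simp

lemma X_mem_P (j : Fin d) : MvPolynomial.X j ∈ P d 1 := by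
  rw [MvPolynomial.mem_restrictTotalDegree]; simp

lemma mul_mem_P {N M : ℕ} {p q : MvPolynomial (Fin d) ℝ} (hp : p ∈ P d N) (hq : q ∈ P d M) :
    p * q ∈ P d (N + M) := by
  rw [MvPolynomial.mem_restrictTotalDegree] at *
  exact (MvPolynomial.totalDegree_mul _ _).trans (by omega)

lemma C_mul_mem_P {N : ℕ} (c : ℝ) {p : MvPolynomial (Fin d) ℝ} (hp : p ∈ P d N) :
    MvPolynomial.C c * p ∈ P d N := by
  rw [MvPolynomial.C_mul']; exact Submodule.smul_mem _ _ hp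

lemma pderiv_mem_P {N : ℕ} (j : Fin d) {p : MvPolynomial (Fin d) ℝ} (hp : p ∈ P d N) :
    MvPolynomial.pderiv j p ∈ P d (N - 1) := by
  rw [p.as_sum, map_sum]
  refine Submodule.sum_mem _ fun m hm => ?_
  rw [MvPolynomial.pderiv_monomial]
  by_cases h0 : m j = 0
  · simp [h0]
  rw [MvPolynomial.mem_restrictTotalDegree] at *
  refine (MvPolynomial.totalDegree_monomial_le _ _).trans ?_
  have h1 : m.degree ≤ N := by
    rw [Finsupp.degree_eq_sum]
    have := (MvPolynomial.le_totalDegree hm).trans hp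
    rwa [Finsupp.sum_fintype _ _ (by simp)] at this
  have h2 : (m - Finsupp.single j 1).degree + 1 = m.degree := by
    have : m - Finsupp.single j 1 + Finsupp.single j 1 = m := by
      apply tsub_add_cancel_of_le
      rw [Finsupp.single_le_iff]; omega
    conv_rhs => rw [← this]
    simp
  exact (show (m - Finsupp.single j 1).degree ≤ N - 1 by omega)

lemma pderiv_mem_P_self {N : ℕ} (j : Fin d) {p : MvPolynomial (Fin d) ℝ} (hp : p ∈ P d N) :
    MvPolynomial.pderiv j p ∈ P d N := P_mono (Nat.sub_le N 1) (pderiv_mem_P j hp)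

/-- Substituting affine polynomials does not raise the degree. -/
lemma aeval_mem_P {N : ℕ} {L : Fin d → MvPolynomial (Fin d) ℝ} (hL : ∀ j, L j ∈ P d 1)
    {p : MvPolynomial (Fin d) ℝ} (hp : p ∈ P d N) : MvPolynomial.aeval L p ∈ P d N := by
  rw [p.as_sum, map_sum]
  refine Submodule.sum_mem _ fun m hm => ?_
  rw [MvPolynomial.aeval_monomial, MvPolynomial.mem_restrictTotalDegree]
  rw [MvPolynomial.mem_restrictTotalDegree] at hp
  refine (MvPolynomial.totalDegree_mul _ _).trans ?_
  rw [MvPolynomial.algebraMap_eq, MvPolynomial.totalDegree_C, zero_add,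
    Finsupp.prod_fintype _ _ (by simp)]
  refine (MvPolynomial.totalDegree_finsetProd _ _).trans ?_
  have h1 := (MvPolynomial.le_totalDegree hm).trans hp
  rw [Finsupp.sum_fintype _ _ (by simp)] at h1
  refine le_trans (Finset.sum_le_sum fun j _ => ?_) h1
  have := (MvPolynomial.mem_restrictTotalDegree _ _ _).1 (hL j)
  exact (MvPolynomial.totalDegree_pow _ _).trans (by nlinarith)

lemma val_aeval (L : Fin d → MvPolynomial (Fin d) ℝ) (p : MvPolynomial (Fin d) ℝ)
    (x : EuclideanSpace ℝ (Fin d)) :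
    val (MvPolynomial.aeval L p) x = val p (WithLp.toLp 2 fun j => val (L j) x) := by
  simp only [val]
  induction p using MvPolynomial.induction_on with
  | C a => simp
  | add p q hp hq => rw [map_add, map_add, map_add, hp, hq]
  | mul_X p i hp => rw [map_mul, map_mul, map_mul, hp]; simp

lemma eq_C_of_pderiv_eq_zero {p : MvPolynomial (Fin d) ℝ}
    (h : ∀ j, MvPolynomial.pderiv j p = 0) : p = MvPolynomial.C (MvPolynomial.coeff 0 p) := by
  ext m
  rw [MvPolynomial.coeff_C]
  split_ifs with hm
  · rw [hm]
  · obtain ⟨j, hj⟩ : ∃ j, m j ≠ 0 := by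
      by_contra! hc
      exact hm (by ext j; simp [hc j])
    have h1 := congrArg (MvPolynomial.coeff (m - Finsupp.single j 1)) (h j)
    rw [MvPolynomial.coeff_pderiv, tsub_add_cancel_of_le
      (by rw [Finsupp.single_le_iff]; omega)] at h1
    rw [MvPolynomial.coeff_zero] at h1
    exact (mul_eq_zero.1 h1).resolve_right (by positivity)

end Polynomials

/-! ### Barycentric coordinates -/

section Barycentric

open scoped RealInnerProductSpace

variable {d : ℕ} (s : Affine.Simplex ℝ (EuclideanSpace ℝ (Fin d)) d)

/-- The vertices of a full-dimensional simplex, as an affine basis. -/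
noncomputable def vertexBasis : AffineBasis (Fin (d + 1)) ℝ (EuclideanSpace ℝ (Fin d)) :=
  ⟨s.points, s.independent, s.independent.affineSpan_eq_top_iff_card_eq_finrank_add_one.2 (by simp)⟩

lemma isCompact_cell : IsCompact (cell s) := (Set.finite_range _).isCompact_convexHull ℝ

lemma convex_cell : Convex ℝ (cell s) := convex_convexHull ℝ _

lemma interior_cell_nonempty : (interior (cell s)).Nonempty :=
  interior_convexHull_nonempty_iff_affineSpan_eq_top.2 (vertexBasis s).tot

lemma points_mem_cell (i : Fin (d + 1)) : s.points i ∈ cell s :=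
  subset_convexHull ℝ _ (Set.mem_range_self i)

lemma face_subset_cell (i : Fin (d + 1)) : face s i ⊆ cell s :=
  convexHull_mono (Set.image_subset_range _ _)

/-- The edge from the vertex `i₀` to the `j`-th of the other vertices. -/
noncomputable def edge (i₀ : Fin (d + 1)) (j : Fin d) : EuclideanSpace ℝ (Fin d) :=
  s.points (i₀.succAbove j) - s.points i₀

lemma norm_edge_le (i₀ : Fin (d + 1)) (j : Fin d) : ‖edge s i₀ j‖ ≤ Metric.diam (cell s) := by
  rw [edge, ← dist_eq_norm]
  exact Metric.dist_le_diam_of_mem (isCompact_cell s).isBounded (points_mem_cell s _)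
    (points_mem_cell s _)

variable [NeZero d]

/-- The barycentric coordinate of the vertex `i`, written through the outward normal of the
opposite face. -/
noncomputable def bary (i : Fin (d + 1)) (x : EuclideanSpace ℝ (Fin d)) : ℝ :=
  1 - (s.height i)⁻¹ * ⟪normal s i, x - s.points i⟫

lemma inner_normal_edge {i k : Fin (d + 1)} (h : k ≠ i) :
    ⟪normal s i, s.points k - s.points i⟫ = s.height i := by
  have h1 := s.inner_vsub_vsub_altitudeFoot_eq_height_sq h.symm
  have h2 := s.height_pos i
  have h3 : normal s i = -((s.height i)⁻¹ • (s.points i - s.altitudeFoot i)) := by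
    rw [normal, vsub_eq_sub, ← smul_neg, neg_sub]
  simp only [vsub_eq_sub] at h1
  rw [h3, inner_neg_left, ← inner_neg_right, neg_sub, real_inner_smul_left, real_inner_comm, h1]
  field_simp

lemma norm_normal (i : Fin (d + 1)) : ‖normal s i‖ = 1 := by
  have h2 := s.height_pos i
  rw [normal, norm_smul, vsub_eq_sub, ← dist_eq_norm, dist_comm, Real.norm_of_nonneg (by positivity)]
  exact inv_mul_cancel₀ h2.ne'

lemma bary_points (i k : Fin (d + 1)) : bary s i (s.points k) = if k = i then 1 else 0 := by
  have h2 := s.height_pos i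
  split_ifs with h
  · simp [bary, h]
  · rw [bary, inner_normal_edge s h, inv_mul_cancel₀ h2.ne', sub_self]

lemma bary_sub (i : Fin (d + 1)) (x y : EuclideanSpace ℝ (Fin d)) :
    bary s i x - bary s i y = -((s.height i)⁻¹ * ⟪normal s i, x - y⟫) := by
  have : x - y = (x - s.points i) - (y - s.points i) := by abel
  rw [this, inner_sub_right, bary, bary]; ring

lemma inner_normal_sub (i : Fin (d + 1)) (x y : EuclideanSpace ℝ (Fin d)) :
    ⟪normal s i, x - y⟫ = s.height i * (bary s i y - bary s i x) := by
  have h2 := s.height_pos i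
  rw [bary_sub, ← neg_sub x y, inner_neg_right]
  field_simp

lemma bary_combination {c : Fin (d + 1) → ℝ} (hc : ∑ k, c k = 1) (i : Fin (d + 1)) :
    bary s i (∑ k, c k • s.points k) = c i := by
  have h : ∑ k, c k • s.points k - s.points i = ∑ k, c k • (s.points k - s.points i) := by
    simp [smul_sub, Finset.sum_sub_distrib, ← Finset.sum_smul, hc]
  have h2 := s.height_pos i
  rw [bary, h, inner_sum, ← Finset.add_sum_erase _ _ (Finset.mem_univ i)]
  have h3 : ∀ k ∈ Finset.univ.erase i, ⟪normal s i, c k • (s.points k - s.points i)⟫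
      = c k * s.height i := fun k hk => by
    rw [real_inner_smul_right, inner_normal_edge s (Finset.ne_of_mem_erase hk)]
  rw [Finset.sum_congr rfl h3, ← Finset.sum_mul, sub_self, smul_zero, inner_zero_right, zero_add]
  have h4 : ∑ k ∈ Finset.univ.erase i, c k = 1 - c i := by
    rw [← hc, ← Finset.add_sum_erase _ _ (Finset.mem_univ i)]; ring
  rw [h4]; field_simp; ring

lemma coord_eq_bary (i : Fin (d + 1)) (x : EuclideanSpace ℝ (Fin d)) :
    (vertexBasis s).coord i x = bary s i x := by
  conv_rhs => rw [← (vertexBasis s).linear_combination_coord_eq_self x]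
  exact (bary_combination s ((vertexBasis s).sum_coord_apply_eq_one x) i).symm

lemma sum_bary (x : EuclideanSpace ℝ (Fin d)) : ∑ i, bary s i x = 1 := by
  simp_rw [← coord_eq_bary]; exact (vertexBasis s).sum_coord_apply_eq_one x

lemma sum_bary_smul (x : EuclideanSpace ℝ (Fin d)) : ∑ i, bary s i x • s.points i = x := by
  simp_rw [← coord_eq_bary]; exact (vertexBasis s).linear_combination_coord_eq_self x

lemma cell_eq : cell s = {x | ∀ i, 0 ≤ bary s i x} := by
  simp_rw [← coord_eq_bary]; exact (vertexBasis s).convexHull_eq_nonneg_coord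

lemma interior_cell : interior (cell s) = {x | ∀ i, 0 < bary s i x} := by
  simp_rw [← coord_eq_bary]; exact (vertexBasis s).interior_convexHull

lemma bary_nonneg {x : EuclideanSpace ℝ (Fin d)} (hx : x ∈ cell s) (i : Fin (d + 1)) :
    0 ≤ bary s i x := by rw [cell_eq] at hx; exact hx i

lemma bary_le_one {x : EuclideanSpace ℝ (Fin d)} (hx : x ∈ cell s) (i : Fin (d + 1)) :
    bary s i x ≤ 1 := by
  rw [← sum_bary s x]
  exact Finset.single_le_sum (fun k _ => bary_nonneg s hx k) (Finset.mem_univ i)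

lemma bary_eq_zero_of_mem_face {i : Fin (d + 1)} {x : EuclideanSpace ℝ (Fin d)}
    (hx : x ∈ face s i) : bary s i x = 0 := by
  have hsub : face s i ⊆ {y | ⟪normal s i, y⟫ = s.height i + ⟪normal s i, s.points i⟫} := by
    refine convexHull_min ?_ (convex_hyperplane (innerₛₗ ℝ (normal s i)).isLinear _)
    rintro _ ⟨k, hk, rfl⟩
    have := inner_normal_edge s (show k ≠ i from hk)
    rw [inner_sub_right] at this
    exact eq_add_of_sub_eq this
  have h2 := s.height_pos i
  rw [bary, inner_sub_right, hsub hx, add_sub_cancel_right, inv_mul_cancel₀ h2.ne', sub_self]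

/-- Every point of the simplex lies on a segment from the vertex `i` to the opposite face. -/
lemma exists_face_projection (i : Fin (d + 1)) {x : EuclideanSpace ℝ (Fin d)} (hx : x ∈ cell s) :
    ∃ y ∈ face s i, x - y = bary s i x • (s.points i - y) := by
  have hins : Set.range s.points = insert (s.points i) (s.points '' {i}ᶜ) := by
    rw [← Set.image_insert_eq, ← Set.image_univ]
    congr 1; ext k; simp [em]
  have hne : (s.points '' {i}ᶜ).Nonempty := by
    obtain ⟨k, hk⟩ := exists_ne i
    exact ⟨_, k, hk, rfl⟩
  rw [cell, hins, convexHull_insert hne, mem_convexJoin] at hx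
  obtain ⟨v, hv, y, hy, a, b, ha, hb, hab, rfl⟩ := hx
  rw [Set.mem_singleton_iff] at hv
  subst hv
  refine ⟨y, hy, ?_⟩
  have hb1 : b = 1 - a := by linarith
  have h0 : a • s.points i + b • y - y = a • (s.points i - y) := by
    rw [hb1]; module
  have h1 : bary s i (a • s.points i + b • y) = a := by
    have h := bary_sub s i (a • s.points i + b • y) y
    rw [h0, bary_eq_zero_of_mem_face s hy, real_inner_smul_right, inner_normal_sub, bary_points,
      bary_eq_zero_of_mem_face s hy] at h
    have h2 := s.height_pos i
    rw [sub_zero] at h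
    rw [h]; simp; field_simp
  rw [h0, h1]

lemma hasFDerivAt_bary (i : Fin (d + 1)) (x : EuclideanSpace ℝ (Fin d)) :
    HasFDerivAt (bary s i) (-(s.height i)⁻¹ • innerSL ℝ (normal s i)) x := by
  have h1 : HasFDerivAt (fun y => innerSL ℝ (normal s i) (y - s.points i))
      (innerSL ℝ (normal s i)) x :=
    (innerSL ℝ (normal s i)).hasFDerivAt.comp x ((hasFDerivAt_id x).sub_const _)
  have h2 := (h1.const_mul (s.height i)⁻¹).const_sub 1
  rw [neg_smul]
  exact h2

@[fun_prop] lemma continuous_bary (i : Fin (d + 1)) : Continuous (bary s i) :=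
  continuous_iff_continuousAt.2 fun x => (hasFDerivAt_bary s i x).continuousAt

/-- The barycentric coordinate as a polynomial of degree one. -/
noncomputable def baryPoly (i : Fin (d + 1)) : MvPolynomial (Fin d) ℝ :=
  MvPolynomial.C (1 + (s.height i)⁻¹ * ⟪normal s i, s.points i⟫)
    - ∑ j, MvPolynomial.C ((s.height i)⁻¹ * normal s i j) * MvPolynomial.X j

lemma baryPoly_mem (i : Fin (d + 1)) : baryPoly s i ∈ P d 1 :=
  Submodule.sub_mem _ (C_mem_P _ _) (Submodule.sum_mem _ fun j _ => C_mul_mem_P _ (X_mem_P j))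

@[simp] lemma val_baryPoly (i : Fin (d + 1)) (x : EuclideanSpace ℝ (Fin d)) :
    val (baryPoly s i) x = bary s i x := by
  have h : ⟪normal s i, x⟫ = ∑ j, normal s i j * x j := by
    simp [PiLp.inner_apply, mul_comm]
  rw [bary, inner_sub_right, h]
  simp only [baryPoly, val_sub, val_C, val_sum, val_mul, val_X, mul_sub, Finset.mul_sum, mul_assoc]
  ring

lemma inner_normal_edge_eq_zero {i₀ i : Fin (d + 1)} {j : Fin d} (h0 : i ≠ i₀)
    (hj : i₀.succAbove j ≠ i) : ⟪normal s i, edge s i₀ j⟫ = 0 := by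
  rw [edge, inner_normal_sub, bary_points, bary_points, if_neg hj, if_neg h0.symm]; simp

lemma inner_normal_edge_ne_zero (i₀ : Fin (d + 1)) (j : Fin d) :
    ⟪normal s (i₀.succAbove j), edge s i₀ j⟫ ≠ 0 := by
  have := s.height_pos (i₀.succAbove j)
  rw [edge, inner_normal_sub, bary_points, bary_points, if_pos rfl,
    if_neg (Fin.succAbove_ne _ _).symm]
  simp [this.ne']

lemma sum_smul_edge (i₀ : Fin (d + 1)) (g : EuclideanSpace ℝ (Fin d)) :
    g = ∑ j, (-((s.height (i₀.succAbove j))⁻¹ * ⟪normal s (i₀.succAbove j), g⟫)) •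
      edge s i₀ j := by
  have hi : ∀ i, bary s i (s.points i₀ + g) = bary s i (s.points i₀)
      + -((s.height i)⁻¹ * ⟪normal s i, g⟫) := fun i => by
    have := bary_sub s i (s.points i₀ + g) (s.points i₀)
    rw [add_sub_cancel_left] at this
    linarith
  have h1 := sum_bary_smul s (s.points i₀ + g)
  have h2 := sum_bary_smul s (s.points i₀)
  have h3 : ∑ i, (-((s.height i)⁻¹ * ⟪normal s i, g⟫)) = 0 := by
    have h4 := sum_bary s (s.points i₀ + g)
    simp_rw [hi, Finset.sum_add_distrib, sum_bary] at h4
    linarith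
  simp_rw [hi, add_smul, Finset.sum_add_distrib, h2] at h1
  have h5 : g = ∑ i, (-((s.height i)⁻¹ * ⟪normal s i, g⟫)) • (s.points i - s.points i₀) := by
    simp_rw [smul_sub, Finset.sum_sub_distrib, ← Finset.sum_smul, h3, zero_smul, sub_zero]
    exact (add_left_cancel h1).symm
  conv_lhs => rw [h5]
  rw [Fin.sum_univ_succAbove _ i₀]
  simp [edge]

lemma inradius_eq : s.inradius = (∑ i, (s.height i)⁻¹)⁻¹ := by
  rw [s.inradius_eq_abs_inv_sum]
  simp only [Affine.Simplex.excenterWeightsUnnorm, Finset.notMem_empty, if_false, one_mul]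
  exact abs_of_nonneg (inv_nonneg.2 (Finset.sum_nonneg fun i _ =>
    inv_nonneg.2 (s.height_pos i).le))

/-- The edges at a vertex resolve every direction at the scale of the inradius. -/
lemma inradius_mul_norm_sq_le (i₀ : Fin (d + 1)) (g : EuclideanSpace ℝ (Fin d)) :
    s.inradius ^ 2 * ‖g‖ ^ 2 ≤ ∑ j, ⟪edge s i₀ j, g⟫ ^ 2 := by
  set S := Real.sqrt (∑ j, ⟪edge s i₀ j, g⟫ ^ 2) with hS
  have hS0 : 0 ≤ ∑ j, ⟪edge s i₀ j, g⟫ ^ 2 := Finset.sum_nonneg fun j _ => sq_nonneg _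
  have hjS : ∀ j, |⟪edge s i₀ j, g⟫| ≤ S := fun j => by
    rw [hS, ← Real.sqrt_sq_eq_abs]
    exact Real.sqrt_le_sqrt (Finset.single_le_sum (f := fun j => ⟪edge s i₀ j, g⟫ ^ 2)
      (fun j _ => sq_nonneg _) (Finset.mem_univ j))
  have hpos : 0 < ∑ i, (s.height i)⁻¹ :=
    Finset.sum_pos (fun i _ => inv_pos.2 (s.height_pos i)) Finset.univ_nonempty
  have key : ‖g‖ ^ 2 ≤ ‖g‖ * S * ∑ i, (s.height i)⁻¹ := by
    rw [← real_inner_self_eq_norm_sq, congrArg (⟪·, g⟫) (sum_smul_edge s i₀ g), sum_inner,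
      Finset.mul_sum, Fin.sum_univ_succAbove _ i₀]
    refine le_trans (Finset.sum_le_sum fun j _ => ?_)
      (le_add_of_nonneg_left (mul_nonneg (mul_nonneg (norm_nonneg _) (Real.sqrt_nonneg _))
        (inv_nonneg.2 (s.height_pos i₀).le)))
    rw [real_inner_smul_left]
    refine (le_abs_self _).trans ?_
    have hh := inv_pos.2 (s.height_pos (i₀.succAbove j))
    have h1 : |⟪normal s (i₀.succAbove j), g⟫| ≤ ‖g‖ := by
      simpa [norm_normal] using abs_real_inner_le_norm (normal s (i₀.succAbove j)) g
    rw [abs_mul, abs_neg, abs_mul, abs_of_pos hh]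
    calc (s.height (i₀.succAbove j))⁻¹ * |⟪normal s (i₀.succAbove j), g⟫| * |⟪edge s i₀ j, g⟫|
        ≤ (s.height (i₀.succAbove j))⁻¹ * ‖g‖ * S :=
          mul_le_mul (mul_le_mul_of_nonneg_left h1 hh.le) (hjS j) (abs_nonneg _) (by positivity)
      _ = _ := by ring
  have h2 : s.inradius * ‖g‖ ≤ S := by
    rcases (norm_nonneg g).eq_or_lt with h0 | h0
    · rw [← h0, mul_zero]; exact Real.sqrt_nonneg _
    · rw [inradius_eq, inv_mul_le_iff₀ hpos]
      have : ‖g‖ * ‖g‖ ≤ ‖g‖ * ((∑ i, (s.height i)⁻¹) * S) := by nlinarith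
      exact le_of_mul_le_mul_left this h0
  rw [← mul_pow, ← Real.sq_sqrt hS0]
  exact pow_le_pow_left₀ (mul_nonneg s.inradius_pos.le (norm_nonneg _)) h2 2

end Barycentric

/-! ### Integrals over the simplex and its faces -/

section Integrals

/-- A continuous function that is nonnegative on a convex body and has integral zero there
vanishes on the body. -/
lemma eq_zero_of_setIntegral_eq_zero {n : ℕ} {K : Set (EuclideanSpace ℝ (Fin n))}
    (hK : IsCompact K) (hconv : Convex ℝ K) (hint : (interior K).Nonempty)
    {f : EuclideanSpace ℝ (Fin n) → ℝ} (hf : Continuous f) (h0 : ∀ x ∈ K, 0 ≤ f x)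
    (h : ∫ x in K, f x = 0) : ∀ x ∈ K, f x = 0 := by
  have hae : f =ᵐ[volume.restrict K] 0 :=
    (setIntegral_eq_zero_iff_of_nonneg_ae
      (ae_restrict_of_forall_mem hK.isClosed.measurableSet h0)
      (hf.continuousOn.integrableOn_compact hK)).1 h
  have hae2 : f =ᵐ[volume.restrict (interior K)] 0 :=
    ae_restrict_of_ae_restrict_of_subset interior_subset hae
  have heq : Set.EqOn f 0 (interior K) :=
    Measure.eqOn_open_of_ae_eq hae2 isOpen_interior hf.continuousOn continuousOn_const
  intro x hx
  have hx2 : x ∈ closure (interior K) := by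
    rw [hconv.closure_interior_eq_closure_of_nonempty_interior hint]
    exact subset_closure hx
  exact heq.closure hf continuous_const hx2

variable {d : ℕ} (s : Affine.Simplex ℝ (EuclideanSpace ℝ (Fin d)) d)

lemma integrableOn_cell {f : EuclideanSpace ℝ (Fin d) → ℝ} (hf : Continuous f) :
    IntegrableOn f (cell s) := hf.continuousOn.integrableOn_compact (isCompact_cell s)

lemma integrableOn_cell_val (p : MvPolynomial (Fin d) ℝ) : IntegrableOn (val p) (cell s) :=
  integrableOn_cell s (continuous_val p)

lemma isCompact_face (i : Fin (d + 1)) : IsCompact (face s i) :=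
  ((Set.toFinite _).image _).isCompact_convexHull ℝ

/-- The hyperplane of a face is an isometric copy of Euclidean space in which the face is a convex
body. -/
lemma exists_face_isometry [NeZero d] (i : Fin (d + 1)) :
    ∃ ι : EuclideanSpace ℝ (Fin (d - 1)) →ᵃⁱ[ℝ] EuclideanSpace ℝ (Fin d),
      face s i ⊆ Set.range ι ∧ (interior (ι ⁻¹' face s i)).Nonempty := by
  obtain ⟨k, hk⟩ := exists_ne i
  set H := affineSpan ℝ (s.points '' {i}ᶜ) with hH
  have hfin : Module.finrank ℝ H.direction = d - 1 := by
    have hcard : (Finset.univ.erase i).card = (d - 1) + 1 := by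
      have := NeZero.pos d
      simp; omega
    have := s.independent.finrank_vectorSpan_image_finset hcard
    rwa [Finset.coe_image, Finset.coe_erase, Finset.coe_univ, ← Set.compl_eq_univ_sdiff,
      ← direction_affineSpan] at this
  have hkH : s.points k ∈ H := subset_affineSpan ℝ _ ⟨k, hk, rfl⟩
  let φ : H.direction ≃ₗᵢ[ℝ] EuclideanSpace ℝ (Fin (d - 1)) :=
    ((stdOrthonormalBasis ℝ H.direction).reindex (finCongr hfin)).repr
  let ι : EuclideanSpace ℝ (Fin (d - 1)) →ᵃⁱ[ℝ] EuclideanSpace ℝ (Fin d) :=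
    (AffineIsometryEquiv.vaddConst ℝ (s.points k)).toAffineIsometry.comp
      (H.direction.subtypeₗᵢ.comp φ.symm.toLinearIsometry).toAffineIsometry
  have hι : ∀ x, ι x = (φ.symm x : EuclideanSpace ℝ (Fin d)) + s.points k := fun x => rfl
  have hmem : ∀ x, ι x ∈ H := fun x => by
    rw [hι]
    exact AffineSubspace.vadd_mem_of_mem_direction (φ.symm x).2 hkH
  have hrange : ∀ y ∈ H, ∃ x, ι x = y := fun y hy => by
    refine ⟨φ ⟨y - s.points k, AffineSubspace.vsub_mem_direction hy hkH⟩, ?_⟩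
    rw [hι, LinearIsometryEquiv.symm_apply_apply]
    exact sub_add_cancel _ _
  have hsub : face s i ⊆ Set.range ι := fun y hy => hrange y (convexHull_subset_affineSpan _ hy)
  refine ⟨ι, hsub, ?_⟩
  have hconv : Convex ℝ (ι ⁻¹' face s i) := (convex_convexHull ℝ _).affine_preimage ι.toAffineMap
  rw [hconv.interior_nonempty_iff_affineSpan_eq_top, ← top_le_iff]
  intro x _
  have hmap : (affineSpan ℝ (ι ⁻¹' face s i)).map ι.toAffineMap = H := by
    rw [AffineSubspace.map_span]
    have : (ι.toAffineMap '' (ι ⁻¹' face s i)) = face s i := Set.image_preimage_eq_of_subset hsub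
    rw [this, face, affineSpan_convexHull]
  have hx := hmem x
  rw [← hmap, AffineSubspace.mem_map] at hx
  obtain ⟨y, hy, hyx⟩ := hx
  rwa [← ι.injective hyx]

/-- The surface integral over a face is a Lebesgue integral over its isometric copy. -/
lemma map_restrict_face {i : Fin (d + 1)}
    (ι : EuclideanSpace ℝ (Fin (d - 1)) →ᵃⁱ[ℝ] EuclideanSpace ℝ (Fin d))
    (hι : face s i ⊆ Set.range ι) :
    (Measure.euclideanHausdorffMeasure (d - 1)).restrict (face s i)
      = (volume.restrict (ι ⁻¹' face s i)).map ι := by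
  have hm : MeasurableSet (face s i) := (isCompact_face s i).isClosed.measurableSet
  rw [← Measure.restrict_map ι.continuous.measurable hm,
    ← EuclideanSpace.euclideanHausdorffMeasure_eq_volume, ι.isometry.map_euclideanHausdorffMeasure,
    Measure.restrict_restrict hm, Set.inter_eq_left.2 hι]

lemma isCompact_preimage_face {i : Fin (d + 1)}
    (ι : EuclideanSpace ℝ (Fin (d - 1)) →ᵃⁱ[ℝ] EuclideanSpace ℝ (Fin d)) :
    IsCompact (ι ⁻¹' face s i) :=
  ι.isometry.isClosedEmbedding.isCompact_preimage (isCompact_face s i)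

lemma integrableOn_face [NeZero d] (i : Fin (d + 1)) {f : EuclideanSpace ℝ (Fin d) → ℝ}
    (hf : Continuous f) :
    IntegrableOn f (face s i) (Measure.euclideanHausdorffMeasure (d - 1)) := by
  obtain ⟨ι, hι, -⟩ := exists_face_isometry s i
  rw [IntegrableOn, map_restrict_face s ι hι,
    ι.isometry.isClosedEmbedding.measurableEmbedding.integrable_map_iff]
  exact (hf.comp ι.continuous).continuousOn.integrableOn_compact (isCompact_preimage_face s ι)

lemma eq_zero_of_face_integral_eq_zero [NeZero d] (i : Fin (d + 1))
    {f : EuclideanSpace ℝ (Fin d) → ℝ} (hf : Continuous f) (h0 : ∀ x ∈ face s i, 0 ≤ f x)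
    (h : ∫ x in face s i, f x ∂(Measure.euclideanHausdorffMeasure (d - 1)) = 0) :
    ∀ x ∈ face s i, f x = 0 := by
  obtain ⟨ι, hι, hint⟩ := exists_face_isometry s i
  rw [map_restrict_face s ι hι,
    ι.isometry.isClosedEmbedding.measurableEmbedding.integral_map] at h
  have := eq_zero_of_setIntegral_eq_zero (isCompact_preimage_face s ι)
    ((convex_convexHull ℝ _).affine_preimage ι.toAffineMap) hint (hf.comp ι.continuous)
    (fun x hx => h0 _ hx) h
  intro x hx
  obtain ⟨y, rfl⟩ := hι hx
  exact this y hx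

lemma eq_zero_of_cell_integral_eq_zero {f : EuclideanSpace ℝ (Fin d) → ℝ} (hf : Continuous f)
    (h0 : ∀ x ∈ cell s, 0 ≤ f x) (h : ∫ x in cell s, f x = 0) : ∀ x ∈ cell s, f x = 0 :=
  eq_zero_of_setIntegral_eq_zero (isCompact_cell s) (convex_cell s) (interior_cell_nonempty s)
    hf h0 h

lemma eq_zero_of_val_eq_zero_cell {p : MvPolynomial (Fin d) ℝ} (h : ∀ x ∈ cell s, val p x = 0) :
    p = 0 :=
  eq_zero_of_val_eq_zero isOpen_interior (interior_cell_nonempty s)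
    fun x hx => h x (interior_subset hx)

end Integrals

/-! ### The gradient as the solution of a linear system -/

section Forms

variable {d : ℕ} (s : Affine.Simplex ℝ (EuclideanSpace ℝ (Fin d)) d)

/-- Integration of polynomials over the simplex. -/
noncomputable def cellInt : MvPolynomial (Fin d) ℝ →ₗ[ℝ] ℝ where
  toFun p := ∫ x in cell s, val p x
  map_add' p q := by
    simp only [val_add]
    exact integral_add (integrableOn_cell_val s p) (integrableOn_cell_val s q)
  map_smul' c p := by
    simp only [val_smul, RingHom.id_apply, smul_eq_mul]
    exact integral_const_mul _ _

lemma cellInt_nonneg {p : MvPolynomial (Fin d) ℝ} (h : ∀ x ∈ cell s, 0 ≤ val p x) :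
    0 ≤ cellInt s p := setIntegral_nonneg (isCompact_cell s).isClosed.measurableSet h

lemma cellInt_mono {p q : MvPolynomial (Fin d) ℝ} (h : ∀ x ∈ cell s, val p x ≤ val q x) :
    cellInt s p ≤ cellInt s q :=
  setIntegral_mono_on (integrableOn_cell_val s p) (integrableOn_cell_val s q)
    (isCompact_cell s).isClosed.measurableSet h

lemma eq_zero_of_cellInt_mul_self {p : MvPolynomial (Fin d) ℝ} (h : cellInt s (p * p) = 0) :
    p = 0 := by
  refine eq_zero_of_val_eq_zero_cell s fun x hx => ?_
  have := eq_zero_of_cell_integral_eq_zero s (continuous_val (p * p))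
    (fun x _ => by rw [val_mul]; exact mul_self_nonneg _) h x hx
  rwa [val_mul, mul_self_eq_zero] at this

lemma innerCell_eq (v w : Fin d → MvPolynomial (Fin d) ℝ) :
    innerCell s v w = cellInt s (∑ j, v j * w j) := by
  exact integral_congr_ae (Filter.Eventually.of_forall fun x => by simp)

/-- The `L²` inner product over the simplex as a bilinear form. -/
noncomputable def cellForm : LinearMap.BilinForm ℝ (Fin d → MvPolynomial (Fin d) ℝ) :=
  LinearMap.mk₂ ℝ (innerCell s)
    (fun v v' w => by simp only [innerCell_eq, ← map_add, ← Finset.sum_add_distrib, ← add_mul,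
      Pi.add_apply])
    (fun c v w => by simp only [innerCell_eq, ← map_smul, Finset.smul_sum, smul_mul_assoc,
      Pi.smul_apply])
    (fun v w w' => by simp only [innerCell_eq, ← map_add, ← Finset.sum_add_distrib, ← mul_add,
      Pi.add_apply])
    (fun c v w => by simp only [innerCell_eq, ← map_smul, Finset.smul_sum, mul_smul_comm,
      Pi.smul_apply])

@[simp] lemma cellForm_apply (v w : Fin d → MvPolynomial (Fin d) ℝ) :
    cellForm s v w = innerCell s v w := rfl

lemma innerCell_self_nonneg (v : Fin d → MvPolynomial (Fin d) ℝ) : 0 ≤ innerCell s v v := by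
  rw [innerCell_eq]
  refine cellInt_nonneg s fun x _ => ?_
  simp only [val_sum, val_mul]
  exact Finset.sum_nonneg fun j _ => mul_self_nonneg _

lemma innerCell_self_eq_sum (v : Fin d → MvPolynomial (Fin d) ℝ) :
    innerCell s v v = ∑ j, cellInt s (v j * v j) := by
  rw [innerCell_eq, map_sum]

lemma eq_zero_of_innerCell_self {v : Fin d → MvPolynomial (Fin d) ℝ} (h : innerCell s v v = 0) :
    v = 0 := by
  rw [innerCell_self_eq_sum, Finset.sum_eq_zero_iff_of_nonneg] at h
  · funext j
    exact eq_zero_of_cellInt_mul_self s (h j (Finset.mem_univ j))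
  · intro j _
    exact cellInt_nonneg s fun x _ => by rw [val_mul]; exact mul_self_nonneg _

lemma innerCell_le_normCell_mul (v w : Fin d → MvPolynomial (Fin d) ℝ) :
    innerCell s v w ≤ normCell s v * normCell s w := by
  have hsymm : LinearMap.IsSymm (cellForm s) :=
    ⟨fun v w => by simp only [cellForm_apply, innerCell_eq, mul_comm, RingHom.id_apply]⟩
  have h := LinearMap.BilinForm.apply_sq_le_of_symm (cellForm s) (innerCell_self_nonneg s)
    hsymm v w
  simp only [cellForm_apply] at h
  rw [normCell, normCell, ← Real.sqrt_mul (innerCell_self_nonneg s v)]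
  exact Real.le_sqrt_of_sq_le h

lemma normCell_sq (v : Fin d → MvPolynomial (Fin d) ℝ) : normCell s v ^ 2 = innerCell s v v :=
  Real.sq_sqrt (innerCell_self_nonneg s v)

/-- The inclusion of the fields with components in `Pᴺ` into all fields of polynomials. -/
noncomputable def fieldIncl (d N : ℕ) : (Fin d → P d N) →ₗ[ℝ] (Fin d → MvPolynomial (Fin d) ℝ) :=
  (P d N).subtype.compLeft (Fin d)

/-- Every linear functional on the fields of degree `N` is represented by a unique field. -/
lemma existsUnique_riesz (N : ℕ) (ℓ : (Fin d → MvPolynomial (Fin d) ℝ) →ₗ[ℝ] ℝ) :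
    ∃! θ : Fin d → MvPolynomial (Fin d) ℝ, (∀ j, θ j ∈ P d N) ∧
      ∀ w : Fin d → MvPolynomial (Fin d) ℝ, (∀ j, w j ∈ P d N) → innerCell s θ w = ℓ w := by
  set B : (Fin d → P d N) →ₗ[ℝ] Module.Dual ℝ (Fin d → P d N) :=
    (cellForm s).compl₁₂ (fieldIncl d N) (fieldIncl d N) with hB
  have hinj : Function.Injective B := by
    rw [injective_iff_map_eq_zero]
    intro v hv
    have h := eq_zero_of_innerCell_self s (v := fieldIncl d N v) (LinearMap.congr_fun hv v)
    funext j
    exact Subtype.ext (congrFun h j)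
  have hsurj : Function.Surjective B :=
    (LinearMap.injective_iff_surjective_of_finrank_eq_finrank
      Subspace.dual_finrank_eq.symm).1 hinj
  obtain ⟨v, hv⟩ := hsurj (ℓ ∘ₗ fieldIncl d N)
  refine ⟨fieldIncl d N v, ⟨fun j => (v j).2, fun w hw => ?_⟩, ?_⟩
  · exact LinearMap.congr_fun hv (fun j => ⟨w j, hw j⟩)
  · rintro θ ⟨hθ, hθw⟩
    have : B (fun j => ⟨θ j, hθ j⟩) = B v := by
      rw [hv]
      exact LinearMap.ext fun w => hθw (fieldIncl d N w) fun j => (w j).2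
    exact congrArg (fieldIncl d N) (hinj this)

variable [NeZero d]

/-- Integration of polynomials over the face opposite to the vertex `i`. -/
noncomputable def faceInt (i : Fin (d + 1)) : MvPolynomial (Fin d) ℝ →ₗ[ℝ] ℝ where
  toFun p := ∫ x in face s i, val p x ∂(Measure.euclideanHausdorffMeasure (d - 1))
  map_add' p q := by
    simp only [val_add]
    exact integral_add (integrableOn_face s i (continuous_val p))
      (integrableOn_face s i (continuous_val q))
  map_smul' c p := by
    simp only [val_smul, RingHom.id_apply, smul_eq_mul]
    exact integral_const_mul _ _

lemma faceInt_eq_zero {i : Fin (d + 1)} {p : MvPolynomial (Fin d) ℝ}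
    (h : ∀ x ∈ face s i, val p x = 0) : faceInt s i p = 0 :=
  setIntegral_eq_zero_of_forall_eq_zero h

lemma val_eq_zero_of_faceInt_mul_self {i : Fin (d + 1)} {p : MvPolynomial (Fin d) ℝ}
    (h : faceInt s i (p * p) = 0) : ∀ x ∈ face s i, val p x = 0 := fun x hx => by
  have := eq_zero_of_face_integral_eq_zero s i (continuous_val (p * p))
    (fun x _ => by rw [val_mul]; exact mul_self_nonneg _) h x hx
  rwa [val_mul, mul_self_eq_zero] at this

/-- The normal component `w ⬝ n` of a field of polynomials, for the normal of the face opposite to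
the vertex `i`. -/
noncomputable def normalPart (i : Fin (d + 1)) :
    (Fin d → MvPolynomial (Fin d) ℝ) →ₗ[ℝ] MvPolynomial (Fin d) ℝ :=
  ∑ j, normal s i j • LinearMap.proj j

lemma normalPart_apply (i : Fin (d + 1)) (w : Fin d → MvPolynomial (Fin d) ℝ) :
    normalPart s i w = ∑ j, normal s i j • w j := by
  simp [normalPart]

lemma val_normalPart (i : Fin (d + 1)) (w : Fin d → MvPolynomial (Fin d) ℝ)
    (x : EuclideanSpace ℝ (Fin d)) :
    val (normalPart s i w) x = inner ℝ (normal s i) (WithLp.toLp 2 fun j => val (w j) x) := by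
  simp [normalPart_apply, PiLp.inner_apply, mul_comm]

lemma normalPart_mem {N : ℕ} (i : Fin (d + 1)) {w : Fin d → MvPolynomial (Fin d) ℝ}
    (hw : ∀ j, w j ∈ P d N) : normalPart s i w ∈ P d N := by
  rw [normalPart_apply]
  exact Submodule.sum_mem _ fun j _ => Submodule.smul_mem _ _ (hw j)

lemma boundaryTerm_eq (β : Fin (d + 1) → ℝ) (u : MvPolynomial (Fin d) ℝ)
    (uExt : Fin (d + 1) → MvPolynomial (Fin d) ℝ) (w : Fin d → MvPolynomial (Fin d) ℝ) :
    boundaryTerm s β u uExt w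
      = ∑ i, (1 / 2 * (1 - β i)) * faceInt s i ((uExt i - u) * normalPart s i w) := by
  refine Finset.sum_congr rfl fun i _ => ?_
  rw [← smul_eq_mul, ← map_smul]
  refine integral_congr_ae (Filter.Eventually.of_forall fun x => ?_)
  simp only [val_smul, val_mul, val_sub, normalPart_apply, val_sum, mul_comm (normal s i _)]
  ring

/-- The surface term as a linear functional of the test field. -/
noncomputable def boundaryForm (β : Fin (d + 1) → ℝ) (u : MvPolynomial (Fin d) ℝ)
    (uExt : Fin (d + 1) → MvPolynomial (Fin d) ℝ) : (Fin d → MvPolynomial (Fin d) ℝ) →ₗ[ℝ] ℝ :=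
  ∑ i, (1 / 2 * (1 - β i)) •
    (faceInt s i ∘ₗ LinearMap.mulLeft ℝ (uExt i - u) ∘ₗ normalPart s i)

lemma boundaryForm_apply (β : Fin (d + 1) → ℝ) (u : MvPolynomial (Fin d) ℝ)
    (uExt : Fin (d + 1) → MvPolynomial (Fin d) ℝ) (w : Fin d → MvPolynomial (Fin d) ℝ) :
    boundaryForm s β u uExt w = boundaryTerm s β u uExt w := by
  rw [boundaryTerm_eq]; simp [boundaryForm]

lemma existsUnique_isLDGGradient (N : ℕ) (β : Fin (d + 1) → ℝ) (u : MvPolynomial (Fin d) ℝ)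
    (uExt : Fin (d + 1) → MvPolynomial (Fin d) ℝ) :
    ∃! θ : Fin d → MvPolynomial (Fin d) ℝ, IsLDGGradient N s β u uExt θ := by
  obtain ⟨θ, ⟨h1, h2⟩, h3⟩ :=
    existsUnique_riesz s N (cellForm s (grad u) + boundaryForm s β u uExt)
  simp only [LinearMap.add_apply, cellForm_apply, boundaryForm_apply] at h2 h3
  exact ⟨θ, ⟨h1, h2⟩, fun θ' h => h3 θ' ⟨h.mem, h.eq⟩⟩

end Forms

/-! ### A weighted norm equivalence, uniform over all simplices -/

section NormEquivalence

/-- A positive definite form on a finite-dimensional space dominates every other form. -/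
lemma exists_form_le {V : Type*} [AddCommGroup V] [Module ℝ V] [FiniteDimensional ℝ V]
    (B₁ B₂ : LinearMap.BilinForm ℝ V) (h₂ : ∀ v, v ≠ 0 → 0 < B₂ v v) :
    ∃ c : ℝ, 0 < c ∧ ∀ v, B₁ v v ≤ c * B₂ v v := by
  let e := (Module.finBasis ℝ V).equivFun
  have hcont : ∀ B : LinearMap.BilinForm ℝ V, Continuous fun x => B (e.symm x) (e.symm x) := by
    intro B
    have : (fun x => B (e.symm x) (e.symm x)) = fun x => ∑ i, ∑ j, x i * (x j *
        B (Module.finBasis ℝ V i) (Module.finBasis ℝ V j)) := by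
      ext x
      simp only [e, Module.Basis.equivFun_symm_apply, map_sum, LinearMap.sum_apply, map_smul,
        LinearMap.smul_apply, smul_eq_mul, Finset.mul_sum]
      rw [Finset.sum_comm]
      exact Finset.sum_congr rfl fun i _ => Finset.sum_congr rfl fun j _ => by ring
    rw [this]
    fun_prop
  have hpos : ∀ x ∈ Metric.sphere (0 : Fin (Module.finrank ℝ V) → ℝ) 1,
      0 < B₂ (e.symm x) (e.symm x) := fun x hx =>
    h₂ _ fun h0 => by
      rw [LinearEquiv.map_eq_zero_iff] at h0
      simp [h0] at hx
  obtain ⟨C, hC⟩ := (isCompact_sphere (0 : Fin (Module.finrank ℝ V) → ℝ) 1).bddAbove_image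
    (f := fun x => B₁ (e.symm x) (e.symm x) / B₂ (e.symm x) (e.symm x))
    ((hcont B₁).continuousOn.div (hcont B₂).continuousOn fun x hx => (hpos x hx).ne')
  refine ⟨max C 1, by positivity, fun v => ?_⟩
  by_cases hv : v = 0
  · simp [hv]
  have hx : e v ≠ 0 := fun h => hv (e.map_eq_zero_iff.1 h)
  have hn : 0 < ‖e v‖ := norm_pos_iff.2 hx
  have hsph : ‖e v‖⁻¹ • e v ∈ Metric.sphere (0 : Fin (Module.finrank ℝ V) → ℝ) 1 := by
    rw [mem_sphere_zero_iff_norm, norm_smul, norm_inv, norm_norm, inv_mul_cancel₀ hn.ne']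
  have h1 := hC ⟨_, hsph, rfl⟩
  have h3 := hpos _ hsph
  simp only at h1
  rw [div_le_iff₀ h3] at h1
  simp only [map_smul, LinearEquiv.symm_apply_apply, LinearMap.smul_apply, smul_eq_mul] at h1
  have h2 := h₂ v hv
  have h4 : B₁ v v ≤ C * B₂ v v := by
    have h5 : ‖e v‖⁻¹ * (‖e v‖⁻¹ * B₁ v v) ≤ ‖e v‖⁻¹ * (‖e v‖⁻¹ * (C * B₂ v v)) := by
      calc _ ≤ _ := h1
        _ = _ := by ring
    have hi := inv_pos.2 hn
    exact le_of_mul_le_mul_left (le_of_mul_le_mul_left h5 hi) hi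
  exact h4.trans (mul_le_mul_of_nonneg_right (le_max_left _ _) h2.le)

variable {d : ℕ} [NeZero d]

/-- The affine map that takes the vertices of `s₀` to those of `s`. -/
noncomputable def vertexMap (s₀ s : Affine.Simplex ℝ (EuclideanSpace ℝ (Fin d)) d)
    (x : EuclideanSpace ℝ (Fin d)) : EuclideanSpace ℝ (Fin d) :=
  ∑ i, bary s₀ i x • s.points i

variable (s₀ s : Affine.Simplex ℝ (EuclideanSpace ℝ (Fin d)) d)

lemma bary_vertexMap (i : Fin (d + 1)) (x : EuclideanSpace ℝ (Fin d)) :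
    bary s i (vertexMap s₀ s x) = bary s₀ i x :=
  bary_combination s (sum_bary s₀ x) i

lemma vertexMap_vertexMap (x : EuclideanSpace ℝ (Fin d)) :
    vertexMap s s₀ (vertexMap s₀ s x) = x := by
  rw [vertexMap]
  simp_rw [bary_vertexMap, sum_bary_smul]

lemma image_vertexMap : vertexMap s₀ s '' cell s₀ = cell s := by
  ext y
  constructor
  · rintro ⟨x, hx, rfl⟩
    rw [cell_eq]
    exact fun i => by rw [bary_vertexMap]; exact bary_nonneg s₀ hx i
  · intro hy
    refine ⟨vertexMap s s₀ y, ?_, vertexMap_vertexMap s s₀ y⟩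
    rw [cell_eq]
    exact fun i => by rw [bary_vertexMap]; exact bary_nonneg s hy i

/-- The coordinates of `vertexMap` as polynomials. -/
noncomputable def vertexPoly (j : Fin d) : MvPolynomial (Fin d) ℝ :=
  ∑ i, s.points i j • baryPoly s₀ i

lemma vertexPoly_mem (j : Fin d) : vertexPoly s₀ s j ∈ P d 1 :=
  Submodule.sum_mem _ fun i _ => Submodule.smul_mem _ _ (baryPoly_mem s₀ i)

lemma val_aeval_vertexPoly (p : MvPolynomial (Fin d) ℝ) (x : EuclideanSpace ℝ (Fin d)) :
    val (MvPolynomial.aeval (vertexPoly s₀ s) p) x = val p (vertexMap s₀ s x) := by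
  rw [val_aeval]
  congr 1
  ext j
  simp [vertexPoly, vertexMap, mul_comm]

lemma exists_cellInt_eq : ∃ D : ℝ, 0 ≤ D ∧ ∀ p : MvPolynomial (Fin d) ℝ,
    cellInt s p = D * cellInt s₀ (MvPolynomial.aeval (vertexPoly s₀ s) p) := by
  set F' : EuclideanSpace ℝ (Fin d) →L[ℝ] EuclideanSpace ℝ (Fin d) :=
    ∑ i, (-(s₀.height i)⁻¹ • innerSL ℝ (normal s₀ i)).smulRight (s.points i)
  have hF : ∀ x, HasFDerivAt (vertexMap s₀ s) F' x := fun x =>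
    HasFDerivAt.fun_sum fun i _ => (hasFDerivAt_bary s₀ i x).smul_const _
  refine ⟨|F'.det|, abs_nonneg _, fun p => ?_⟩
  have h := integral_image_eq_integral_abs_det_fderiv_smul volume
    (isCompact_cell s₀).isClosed.measurableSet (fun x _ => (hF x).hasFDerivWithinAt)
    (Function.LeftInverse.injective (vertexMap_vertexMap s₀ s)).injOn (val p)
  rw [image_vertexMap] at h
  simp only [cellInt, LinearMap.coe_mk, AddHom.coe_mk, val_aeval_vertexPoly]
  rw [h]
  simp only [smul_eq_mul]
  exact integral_const_mul _ _

lemma baryPoly_ne_zero (i : Fin (d + 1)) : baryPoly s i ≠ 0 := fun h => by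
  have h1 := val_baryPoly s i (s.points i)
  rw [h, bary_points] at h1
  simp at h1

lemma exists_cellInt_le_of_simplex (N : ℕ) (i : Fin (d + 1)) :
    ∃ c : ℝ, 0 < c ∧ ∀ q ∈ P d N, cellInt s (q * q) ≤ c * cellInt s (baryPoly s i * (q * q)) := by
  let B₁ : LinearMap.BilinForm ℝ (P d N) :=
    ((LinearMap.mul ℝ (MvPolynomial (Fin d) ℝ)).compr₂ (cellInt s)).domRestrict₁₂ _ _
  let B₂ : LinearMap.BilinForm ℝ (P d N) :=
    ((LinearMap.mul ℝ (MvPolynomial (Fin d) ℝ)).compr₂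
      (cellInt s ∘ₗ LinearMap.mulLeft ℝ (baryPoly s i))).domRestrict₁₂ _ _
  have hB₂ : ∀ v : P d N, B₂ v v = cellInt s (baryPoly s i * (v.1 * v.1)) := fun v => rfl
  have hnn : ∀ (v : P d N), ∀ x ∈ cell s, 0 ≤ val (baryPoly s i * (v.1 * v.1)) x := by
    intro v x hx
    simp only [val_mul, val_baryPoly]
    exact mul_nonneg (bary_nonneg s hx i) (mul_self_nonneg _)
  obtain ⟨c, hc, h⟩ := exists_form_le B₁ B₂ fun v hv => by
    rw [hB₂]
    refine lt_of_le_of_ne (cellInt_nonneg s (hnn v)) fun h0 => hv ?_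
    have h1 := eq_zero_of_val_eq_zero_cell s
      (eq_zero_of_cell_integral_eq_zero s (continuous_val _) (hnn v) h0.symm)
    have h2 := (mul_eq_zero.1 h1).resolve_left (baryPoly_ne_zero s i)
    exact Subtype.ext (mul_self_eq_zero.1 h2)
  exact ⟨c, hc, fun q hq => h ⟨q, hq⟩⟩

/-- Weighting the `L²` norm on `Pᴺ` with a barycentric coordinate gives an equivalent norm, with a
constant that is the same for all simplices: an affine map carries one simplex to another and
multiplies both integrals by the same determinant. -/
lemma exists_cellInt_le (d N : ℕ) [NeZero d] : ∃ c : ℝ, 0 < c ∧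
    ∀ (s : Affine.Simplex ℝ (EuclideanSpace ℝ (Fin d)) d) (i : Fin (d + 1)), ∀ q ∈ P d N,
      cellInt s (q * q) ≤ c * cellInt s (baryPoly s i * (q * q)) := by
  -- Any simplex serves as the reference simplex.
  rcases isEmpty_or_nonempty (Affine.Simplex ℝ (EuclideanSpace ℝ (Fin d)) d) with h | ⟨⟨s₀⟩⟩
  · exact ⟨1, one_pos, fun s => h.elim s⟩
  choose c hc h using exists_cellInt_le_of_simplex s₀ N
  refine ⟨∑ i, c i, Finset.sum_pos (fun i _ => hc i) Finset.univ_nonempty, fun s i q hq => ?_⟩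
  obtain ⟨D, hD, hDs⟩ := exists_cellInt_eq s₀ s
  have hw : ∀ p, cellInt s₀ (MvPolynomial.aeval (vertexPoly s₀ s) (baryPoly s i * p))
      = cellInt s₀ (baryPoly s₀ i * MvPolynomial.aeval (vertexPoly s₀ s) p) := fun p =>
    integral_congr_ae (Filter.Eventually.of_forall fun x => by
      simp only [val_mul, val_baryPoly, val_aeval_vertexPoly, bary_vertexMap])
  set q' := MvPolynomial.aeval (vertexPoly s₀ s) q with hq'
  have h1 := h i q' (aeval_mem_P (vertexPoly_mem s₀ s) hq)
  have h2 : 0 ≤ cellInt s₀ (baryPoly s₀ i * (q' * q')) := cellInt_nonneg s₀ fun x hx => by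
    simp only [val_mul, val_baryPoly]
    exact mul_nonneg (bary_nonneg s₀ hx i) (mul_self_nonneg _)
  rw [hDs, hDs, hw, map_mul, ← hq']
  calc D * cellInt s₀ (q' * q') ≤ D * ((∑ i, c i) * cellInt s₀ (baryPoly s₀ i * (q' * q'))) :=
        mul_le_mul_of_nonneg_left (h1.trans (mul_le_mul_of_nonneg_right
          (Finset.single_le_sum (fun k _ => (hc k).le) (Finset.mem_univ i)) h2)) hD
    _ = _ := by ring

end NormEquivalence

/-! ### The gradient estimate -/

section Estimate

open scoped RealInnerProductSpace

variable {d : ℕ} (s : Affine.Simplex ℝ (EuclideanSpace ℝ (Fin d)) d)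

/-- The field `∑ j, q j • e j`, where `e j` are the edges at the vertex `i₀`. -/
noncomputable def edgeField (i₀ : Fin (d + 1)) (q : Fin d → MvPolynomial (Fin d) ℝ) :
    Fin d → MvPolynomial (Fin d) ℝ :=
  fun k => ∑ j, edge s i₀ j k • q j

/-- The component `v ⬝ e j` of a field, where `e j` are the edges at the vertex `i₀`. -/
noncomputable def edgePart (i₀ : Fin (d + 1)) (j : Fin d) (v : Fin d → MvPolynomial (Fin d) ℝ) :
    MvPolynomial (Fin d) ℝ :=
  ∑ k, edge s i₀ j k • v k

lemma edgeField_mem {N : ℕ} (i₀ : Fin (d + 1)) {q : Fin d → MvPolynomial (Fin d) ℝ}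
    (hq : ∀ j, q j ∈ P d N) (k : Fin d) : edgeField s i₀ q k ∈ P d N :=
  Submodule.sum_mem _ fun j _ => Submodule.smul_mem _ _ (hq j)

lemma val_edgePart (i₀ : Fin (d + 1)) (j : Fin d) (v : Fin d → MvPolynomial (Fin d) ℝ)
    (x : EuclideanSpace ℝ (Fin d)) :
    val (edgePart s i₀ j v) x = ⟪edge s i₀ j, WithLp.toLp 2 fun k => val (v k) x⟫ := by
  simp [edgePart, PiLp.inner_apply, mul_comm]

lemma toLp_val_edgeField (i₀ : Fin (d + 1)) (q : Fin d → MvPolynomial (Fin d) ℝ)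
    (x : EuclideanSpace ℝ (Fin d)) :
    WithLp.toLp 2 (fun k => val (edgeField s i₀ q k) x) = ∑ j, val (q j) x • edge s i₀ j := by
  ext k
  simp [edgeField, mul_comm]

lemma innerCell_edgeField (i₀ : Fin (d + 1)) (v q : Fin d → MvPolynomial (Fin d) ℝ) :
    innerCell s v (edgeField s i₀ q) = ∑ j, cellInt s (edgePart s i₀ j v * q j) := by
  rw [innerCell_eq, ← map_sum]
  congr 1
  simp only [edgeField, edgePart, Finset.mul_sum, Finset.sum_mul]
  rw [Finset.sum_comm]
  simp

variable [NeZero d]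

/-- On a face through the vertex `i₀`, the normal component of an edge field only sees the edge
that leaves the face. -/
lemma val_normalPart_edgeField (i₀ : Fin (d + 1)) (j : Fin d)
    (q : Fin d → MvPolynomial (Fin d) ℝ) (x : EuclideanSpace ℝ (Fin d)) :
    val (normalPart s (i₀.succAbove j) (edgeField s i₀ q)) x
      = ⟪normal s (i₀.succAbove j), edge s i₀ j⟫ * val (q j) x := by
  rw [val_normalPart, toLp_val_edgeField, inner_sum, Finset.sum_eq_single j]
  · rw [real_inner_smul_right, mul_comm]
  · intro k _ hk
    rw [real_inner_smul_right, inner_normal_edge_eq_zero s (Fin.succAbove_ne _ _)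
      (fun h => hk (Fin.succAbove_right_injective h)), mul_zero]
  · simp

/-- The face opposite to `i₀` drops out since `β i₀ = 1`, and each other face sees one component. -/
lemma boundaryTerm_edgeField {β : Fin (d + 1) → ℝ} {i₀ : Fin (d + 1)} (hβ : β i₀ = 1)
    (u : MvPolynomial (Fin d) ℝ) (uExt : Fin (d + 1) → MvPolynomial (Fin d) ℝ)
    (q : Fin d → MvPolynomial (Fin d) ℝ) :
    boundaryTerm s β u uExt (edgeField s i₀ q)
      = ∑ j, (1 / 2 * (1 - β (i₀.succAbove j))) * (⟪normal s (i₀.succAbove j), edge s i₀ j⟫ *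
        faceInt s (i₀.succAbove j) ((uExt (i₀.succAbove j) - u) * q j)) := by
  rw [boundaryTerm_eq, Fin.sum_univ_succAbove _ i₀, hβ, sub_self, mul_zero, zero_mul, zero_add]
  refine Finset.sum_congr rfl fun j _ => ?_
  rw [← smul_eq_mul (⟪_, _⟫), ← map_smul]
  congr 1
  refine integral_congr_ae (Filter.Eventually.of_forall fun x => ?_)
  simp only [val_smul, val_mul, val_normalPart_edgeField]
  ring

lemma baryPoly_mul_pderiv_mem {N : ℕ} {u : MvPolynomial (Fin d) ℝ} (hu : u ∈ P d N)
    (i i₀ : Fin (d + 1)) (j : Fin d) :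
    baryPoly s i * edgePart s i₀ j (grad u) ∈ P d N := by
  -- For `N = 0` the truncated degree bound `N - 1` is useless, but then the gradient is zero.
  rcases Nat.eq_zero_or_pos N with rfl | hN
  · have h0 : grad u = 0 := by
      rw [MvPolynomial.mem_restrictTotalDegree, Nat.le_zero,
        MvPolynomial.totalDegree_eq_zero_iff_eq_C] at hu
      funext k
      rw [grad, hu]
      exact MvPolynomial.pderiv_C
    simp [h0, edgePart]
  · have h1 : edgePart s i₀ j (grad u) ∈ P d (N - 1) :=
      Submodule.sum_mem _ fun k _ => Submodule.smul_mem _ _ (pderiv_mem_P k hu)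
    have := mul_mem_P (baryPoly_mem s i) h1
    rwa [show 1 + (N - 1) = N by omega] at this

lemma inradius_sq_mul_innerCell_le (i₀ : Fin (d + 1)) (v : Fin d → MvPolynomial (Fin d) ℝ) :
    s.inradius ^ 2 * innerCell s v v
      ≤ ∑ j, cellInt s (edgePart s i₀ j v * edgePart s i₀ j v) := by
  rw [innerCell_eq, ← smul_eq_mul, ← map_smul, ← map_sum]
  refine cellInt_mono s fun x _ => ?_
  have h := inradius_mul_norm_sq_le s i₀ (WithLp.toLp 2 fun k => val (v k) x)
  simpa [val_edgePart, EuclideanSpace.norm_sq_eq, ← sq] using h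

lemma innerCell_edgeField_self_le (i₀ : Fin (d + 1)) (q : Fin d → MvPolynomial (Fin d) ℝ) :
    innerCell s (edgeField s i₀ fun j => baryPoly s (i₀.succAbove j) * q j)
        (edgeField s i₀ fun j => baryPoly s (i₀.succAbove j) * q j)
      ≤ d * Metric.diam (cell s) ^ 2 * ∑ j, cellInt s (q j * q j) := by
  set w := edgeField s i₀ fun j => baryPoly s (i₀.succAbove j) * q j with hw
  set h := Metric.diam (cell s)
  rw [innerCell_eq, ← map_sum, ← smul_eq_mul, ← map_smul]
  refine cellInt_mono s fun x hx => ?_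
  have h1 : val (∑ k, w k * w k) x = ‖∑ j, (bary s (i₀.succAbove j) x * val (q j) x) •
      edge s i₀ j‖ ^ 2 := by
    have := toLp_val_edgeField s i₀ (fun j => baryPoly s (i₀.succAbove j) * q j) x
    simp only [val_mul, val_baryPoly] at this
    rw [← this, EuclideanSpace.norm_sq_eq]
    simp [hw, ← sq]
  have h2 : ‖∑ j, (bary s (i₀.succAbove j) x * val (q j) x) • edge s i₀ j‖
      ≤ ∑ j, |val (q j) x| * h := by
    refine (norm_sum_le _ _).trans (Finset.sum_le_sum fun j _ => ?_)
    rw [norm_smul, Real.norm_eq_abs, abs_mul, abs_of_nonneg (bary_nonneg s hx _)]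
    refine mul_le_mul ?_ (norm_edge_le s i₀ j) (norm_nonneg _) (abs_nonneg _)
    exact mul_le_of_le_one_left (abs_nonneg _) (bary_le_one s hx _)
  have h3 : (∑ j, |val (q j) x|) ^ 2 ≤ d * ∑ j, val (q j) x ^ 2 := by
    have := sq_sum_le_card_mul_sum_sq (s := Finset.univ) (f := fun j => |val (q j) x|)
    simpa using this
  rw [h1]
  calc ‖∑ j, (bary s (i₀.succAbove j) x * val (q j) x) • edge s i₀ j‖ ^ 2
      ≤ (∑ j, |val (q j) x| * h) ^ 2 := pow_le_pow_left₀ (norm_nonneg _) h2 2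
    _ = (∑ j, |val (q j) x|) ^ 2 * h ^ 2 := by rw [← Finset.sum_mul, mul_pow]
    _ ≤ (d * ∑ j, val (q j) x ^ 2) * h ^ 2 := mul_le_mul_of_nonneg_right h3 (sq_nonneg _)
    _ = _ := by simp [← sq]; ring

/-- The gradient is controlled by the LDG gradient. The test field `∑ j, λ j (e j ⬝ ∇u) e j`, for
the edges `e j` at a vertex opposite to a face with `β = 1` and the barycentric coordinates `λ j` of
their far ends, has vanishing normal component on all other faces. -/
lemma exists_normCell_grad_le (d N : ℕ) [NeZero d] (κ : ℝ) : ∃ C : ℝ, 0 < C ∧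
    ∀ s : Affine.Simplex ℝ (EuclideanSpace ℝ (Fin d)) d, ShapeRegular κ s →
    ∀ β : Fin (d + 1) → ℝ, (∃ i, β i = 1) →
    ∀ u ∈ P d N, ∀ (uExt : Fin (d + 1) → MvPolynomial (Fin d) ℝ)
      (θ : Fin d → MvPolynomial (Fin d) ℝ), IsLDGGradient N s β u uExt θ →
        normCell s (grad u) ≤ C * normCell s θ := by
  obtain ⟨c, hc, hcs⟩ := exists_cellInt_le d N
  refine ⟨max 1 (c * Real.sqrt d * κ), lt_max_of_lt_left one_pos, ?_⟩
  rintro s hs β ⟨i₀, hβ⟩ u hu uExt θ hθ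
  set D : Fin d → MvPolynomial (Fin d) ℝ := fun j => edgePart s i₀ j (grad u) with hD
  set w := edgeField s i₀ fun j => baryPoly s (i₀.succAbove j) * D j with hw
  have hDmem : ∀ j, D j ∈ P d N := fun j =>
    Submodule.sum_mem _ fun k _ => Submodule.smul_mem _ _ (pderiv_mem_P_self k hu)
  have hθw := hθ.eq w (edgeField_mem s i₀ fun j => baryPoly_mul_pderiv_mem s hu _ i₀ j)
  have hbd : boundaryTerm s β u uExt w = 0 := by
    rw [hw, boundaryTerm_edgeField s hβ]
    refine Finset.sum_eq_zero fun j _ => ?_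
    rw [faceInt_eq_zero, mul_zero, mul_zero]
    intro x hx
    simp [bary_eq_zero_of_mem_face s hx]
  set A := ∑ j, cellInt s (D j * D j) with hA
  have hA0 : 0 ≤ A := Finset.sum_nonneg fun j _ => cellInt_nonneg s fun x _ => by
    rw [val_mul]; exact mul_self_nonneg _
  have h1 : A ≤ c * innerCell s θ w := by
    rw [hθw, hbd, add_zero, hw, innerCell_edgeField, Finset.mul_sum]
    refine Finset.sum_le_sum fun j _ => (hcs s (i₀.succAbove j) (D j) (hDmem j)).trans_eq ?_
    rw [mul_left_comm]
  have h2 : normCell s w ≤ Real.sqrt d * Metric.diam (cell s) * Real.sqrt A := by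
    have h := innerCell_edgeField_self_le s i₀ D
    rw [normCell, ← Real.sqrt_sq (Metric.diam_nonneg (s := cell s)),
      ← Real.sqrt_mul (Nat.cast_nonneg d), ← Real.sqrt_mul (by positivity)]
    exact Real.sqrt_le_sqrt h
  have h3 : s.inradius * normCell s (grad u) ≤ Real.sqrt A := by
    refine Real.le_sqrt_of_sq_le ?_
    rw [mul_pow, normCell_sq]
    exact inradius_sq_mul_innerCell_le s i₀ (grad u)
  have hθ0 : 0 ≤ normCell s θ := Real.sqrt_nonneg _
  have hr := s.inradius_pos
  have h4 : Real.sqrt A ≤ c * normCell s θ * (Real.sqrt d * Metric.diam (cell s)) := by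
    rcases (Real.sqrt_nonneg A).eq_or_lt with h0 | h0
    · rw [← h0]
      exact mul_nonneg (mul_nonneg hc.le hθ0) (mul_nonneg (Real.sqrt_nonneg _) Metric.diam_nonneg)
    · refine le_of_mul_le_mul_right ?_ h0
      rw [Real.mul_self_sqrt hA0]
      calc A ≤ c * innerCell s θ w := h1
        _ ≤ c * (normCell s θ * normCell s w) :=
          mul_le_mul_of_nonneg_left (innerCell_le_normCell_mul s θ w) hc.le
        _ ≤ c * (normCell s θ * (Real.sqrt d * Metric.diam (cell s) * Real.sqrt A)) := by gcongr
        _ = _ := by ring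
  have h5 : s.inradius * normCell s (grad u)
      ≤ s.inradius * (c * Real.sqrt d * κ * normCell s θ) := by
    calc s.inradius * normCell s (grad u)
        ≤ c * normCell s θ * (Real.sqrt d * Metric.diam (cell s)) := h3.trans h4
      _ ≤ c * normCell s θ * (Real.sqrt d * (κ * s.inradius)) := by
        have := hs
        unfold ShapeRegular at this
        gcongr
      _ = _ := by ring
  exact (le_of_mul_le_mul_left h5 hr).trans
    (mul_le_mul_of_nonneg_right (le_max_right _ _) hθ0)

end Estimate

/-! ### The null space -/

section NullSpace

open scoped RealInnerProductSpace

variable {d : ℕ} [NeZero d] (s : Affine.Simplex ℝ (EuclideanSpace ℝ (Fin d)) d)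

lemma isLDGGradient_zero_iff {N : ℕ} {β : Fin (d + 1) → ℝ} (hβ : ∃ i, β i = 1)
    {u : MvPolynomial (Fin d) ℝ} (hu : u ∈ P d N)
    {uExt : Fin (d + 1) → MvPolynomial (Fin d) ℝ} (huExt : ∀ i, uExt i ∈ P d N) :
    IsLDGGradient N s β u uExt 0 ↔
      ∃ c : ℝ, u = MvPolynomial.C c ∧ ∀ i, β i ≠ 1 → ∀ x ∈ face s i, val (uExt i) x = c := by
  have h00 : ∀ w, innerCell s 0 w = 0 := fun w => LinearMap.map_zero₂ (cellForm s) w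
  constructor
  · intro h
    obtain ⟨C, -, hC⟩ := exists_normCell_grad_le d N (Metric.diam (cell s) / s.inradius)
    have hreg : ShapeRegular (Metric.diam (cell s) / s.inradius) s :=
      (div_mul_cancel₀ _ s.inradius_pos.ne').ge
    have hle := hC s hreg β hβ u hu uExt 0 h
    have hz : normCell s 0 = 0 := by rw [normCell, h00, Real.sqrt_zero]
    rw [hz, mul_zero] at hle
    have hg : grad u = 0 := by
      refine eq_zero_of_innerCell_self s ?_
      rw [← normCell_sq, le_antisymm hle (Real.sqrt_nonneg _)]
      norm_num
    have huc := eq_C_of_pderiv_eq_zero (fun j => congrFun hg j)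
    refine ⟨_, huc, fun i hi x hx => ?_⟩
    obtain ⟨i₀, hi₀⟩ := hβ
    obtain ⟨j, rfl⟩ : ∃ j, i₀.succAbove j = i :=
      Fin.exists_succAbove_eq (fun h => hi (h ▸ hi₀))
    have hmem : ∀ k, (Pi.single j (uExt (i₀.succAbove j) - u) : Fin d → _) k ∈ P d N := by
      intro k
      by_cases hk : k = j
      · subst hk
        rw [Pi.single_eq_same]
        exact Submodule.sub_mem _ (huExt _) hu
      · rw [Pi.single_eq_of_ne hk]
        exact Submodule.zero_mem _
    have hw := h.eq _ (edgeField_mem s i₀ hmem)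
    rw [h00, hg, h00, zero_add, boundaryTerm_edgeField s hi₀, Finset.sum_eq_single j,
      Pi.single_eq_same] at hw
    · have h1 : 1 / 2 * (1 - β (i₀.succAbove j)) ≠ 0 := by
        have : 1 - β (i₀.succAbove j) ≠ 0 := sub_ne_zero.2 (Ne.symm hi)
        positivity
      have h2 := ((mul_eq_zero.1 ((mul_eq_zero.1 hw.symm).resolve_left h1)).resolve_left
        (inner_normal_edge_ne_zero s i₀ j))
      have h3 := val_eq_zero_of_faceInt_mul_self s h2 x hx
      rw [val_sub, sub_eq_zero] at h3
      rw [h3]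
      conv_lhs => rw [huc]
      exact val_C _ _
    · intro k _ hk
      simp [Pi.single_eq_of_ne hk]
    · simp
  · rintro ⟨c, rfl, hc⟩
    refine ⟨fun j => Submodule.zero_mem _, fun w hw => ?_⟩
    have hg : grad (MvPolynomial.C c : MvPolynomial (Fin d) ℝ) = 0 := by
      funext j; exact MvPolynomial.pderiv_C
    rw [hg, h00, zero_add, boundaryTerm_eq]
    refine (Finset.sum_eq_zero fun i _ => ?_).symm
    by_cases hi : β i = 1
    · rw [hi]; ring
    · rw [faceInt_eq_zero, mul_zero]
      intro x hx
      simp [hc i hi x hx]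

end NullSpace

/-! ### The divergence theorem for fields with vanishing normal component -/

section Divergence

open scoped RealInnerProductSpace
open Filter Topology

/-- A smooth cutoff `ψ` with `ψ = 0` on `(-∞, 1]` and `ψ = 1` on `[2, ∞)`. -/
lemma exists_cutoff : ∃ (ψ : ℝ → ℝ) (K : ℝ), ContDiff ℝ 1 ψ ∧ (∀ t < 1, ψ t = 0) ∧
    (∀ t, 2 ≤ t → ψ t = 1) ∧ (∀ t, |ψ t| ≤ 1) ∧ (∀ t, 0 ≤ t → |t * deriv ψ t| ≤ K) ∧
    ∀ t, 2 < t → deriv ψ t = 0 := by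
  have hcd : ContDiff ℝ 1 fun t : ℝ => Real.smoothTransition (t - 1) :=
    Real.smoothTransition.contDiff.comp (contDiff_id.sub contDiff_const)
  have hd : ∀ t : ℝ, 2 < t → deriv (fun t : ℝ => Real.smoothTransition (t - 1)) t = 0 := by
    intro t ht
    have : (fun t : ℝ => Real.smoothTransition (t - 1)) =ᶠ[𝓝 t] fun _ => 1 := by
      filter_upwards [lt_mem_nhds ht] with y hy
      exact Real.smoothTransition.one_of_one_le (by linarith)
    rw [this.deriv_eq, deriv_const]
  have hcont : Continuous fun t => |t * deriv (fun t : ℝ => Real.smoothTransition (t - 1)) t| :=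
    (continuous_id.mul (hcd.continuous_deriv le_rfl)).abs
  obtain ⟨K, hK⟩ := (isCompact_Icc (a := (0 : ℝ)) (b := 2)).bddAbove_image hcont.continuousOn
  have hK0 : 0 ≤ K := (abs_nonneg _).trans (hK ⟨0, by norm_num, rfl⟩)
  refine ⟨fun t => Real.smoothTransition (t - 1), K, hcd, fun t ht => ?_, fun t ht => ?_,
    fun t => ?_, fun t ht => ?_, hd⟩
  · exact Real.smoothTransition.zero_of_nonpos (by linarith)
  · exact Real.smoothTransition.one_of_one_le (by linarith)
  · rw [abs_of_nonneg (Real.smoothTransition.nonneg _)]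
    exact Real.smoothTransition.le_one _
  · rcases le_or_gt t 2 with h | h
    · exact hK ⟨t, ⟨ht, h⟩, rfl⟩
    · rw [hd t h, mul_zero, abs_zero]; exact hK0

variable {d : ℕ} [NeZero d] (s : Affine.Simplex ℝ (EuclideanSpace ℝ (Fin d)) d)

/-- A polynomial that vanishes on a face is bounded on the simplex by a multiple of the barycentric
coordinate that defines the face. -/
lemma exists_abs_val_le_bary (i : Fin (d + 1)) {p : MvPolynomial (Fin d) ℝ}
    (hp : ∀ x ∈ face s i, val p x = 0) :
    ∃ M : ℝ, 0 ≤ M ∧ ∀ x ∈ cell s, |val p x| ≤ M * bary s i x := by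
  have hcont : Continuous fun x => ‖∑ j, val (MvPolynomial.pderiv j p) x •
      (EuclideanSpace.proj j : EuclideanSpace ℝ (Fin d) →L[ℝ] ℝ)‖ := by fun_prop
  obtain ⟨K, hK⟩ := (isCompact_cell s).bddAbove_image hcont.continuousOn
  have hK0 : 0 ≤ K := (norm_nonneg _).trans (hK ⟨_, points_mem_cell s i, rfl⟩)
  refine ⟨K * Metric.diam (cell s), mul_nonneg hK0 Metric.diam_nonneg, fun x hx => ?_⟩
  obtain ⟨y, hy, hxy⟩ := exists_face_projection s i hx
  have h1 := (convex_cell s).norm_image_sub_le_of_norm_hasFDerivWithin_le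
    (fun z _ => (hasFDerivAt_val p z).hasFDerivWithinAt) (fun z hz => hK ⟨z, hz, rfl⟩)
    (face_subset_cell s i hy) hx
  rw [hp y hy, sub_zero, hxy, norm_smul, Real.norm_eq_abs, Real.norm_eq_abs,
    abs_of_nonneg (bary_nonneg s hx i)] at h1
  have h2 : ‖s.points i - y‖ ≤ Metric.diam (cell s) := by
    rw [← dist_eq_norm]
    exact Metric.dist_le_diam_of_mem (isCompact_cell s).isBounded (points_mem_cell s i)
      (face_subset_cell s i hy)
  calc |val p x| ≤ K * (bary s i x * ‖s.points i - y‖) := h1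
    _ ≤ K * (bary s i x * Metric.diam (cell s)) := by
      have := bary_nonneg s hx i
      gcongr
    _ = _ := by ring

/-- The bubble function: the product of the barycentric coordinates, which is positive inside the
simplex and zero on its boundary. -/
noncomputable def bubble (x : EuclideanSpace ℝ (Fin d)) : ℝ := ∏ i, bary s i x

/-- The derivative of the bubble function. -/
noncomputable def bubbleDeriv (x : EuclideanSpace ℝ (Fin d)) : EuclideanSpace ℝ (Fin d) →L[ℝ] ℝ :=
  ∑ i, (∏ j ∈ Finset.univ.erase i, bary s j x) • (-(s.height i)⁻¹ • innerSL ℝ (normal s i))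

lemma hasFDerivAt_bubble (x : EuclideanSpace ℝ (Fin d)) :
    HasFDerivAt (bubble s) (bubbleDeriv s x) x :=
  HasFDerivAt.finsetProd fun i _ => hasFDerivAt_bary s i x

@[fun_prop] lemma continuous_bubble : Continuous (bubble s) := by unfold bubble; fun_prop

@[fun_prop] lemma continuous_bubbleDeriv : Continuous (bubbleDeriv s) := by
  unfold bubbleDeriv; fun_prop

lemma bubble_pos {x : EuclideanSpace ℝ (Fin d)} (hx : x ∈ interior (cell s)) :
    0 < bubble s x := by
  rw [interior_cell] at hx
  exact Finset.prod_pos fun i _ => hx i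

lemma bubble_eq_zero {x : EuclideanSpace ℝ (Fin d)} (hx : x ∈ cell s)
    (hx' : x ∉ interior (cell s)) : bubble s x = 0 := by
  rw [interior_cell] at hx'
  obtain ⟨i, hi⟩ := not_forall.1 hx'
  exact Finset.prod_eq_zero (Finset.mem_univ i)
    (le_antisymm (not_lt.1 hi) (bary_nonneg s hx i))

/-- If the normal component of a field vanishes on the boundary, then the derivative of the bubble
function along the field is at most a multiple of the bubble function: near a face the normal
component decays like the factor of the bubble function that it removes. -/
lemma exists_bubbleDeriv_le {V : Fin d → MvPolynomial (Fin d) ℝ}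
    (hV : ∀ i, ∀ x ∈ face s i, val (normalPart s i V) x = 0) :
    ∃ M : ℝ, 0 ≤ M ∧ ∀ x ∈ cell s,
      |bubbleDeriv s x (WithLp.toLp 2 fun j => val (V j) x)| ≤ M * bubble s x := by
  choose M hM0 hM using fun i => exists_abs_val_le_bary s i (hV i)
  have hh := fun i => inv_pos.2 (s.height_pos i)
  refine ⟨∑ i, (s.height i)⁻¹ * M i,
    Finset.sum_nonneg fun i _ => mul_nonneg (hh i).le (hM0 i), fun x hx => ?_⟩
  rw [bubbleDeriv, sum_apply, Finset.sum_mul]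
  refine (Finset.abs_sum_le_sum_abs _ _).trans (Finset.sum_le_sum fun i _ => ?_)
  have hP : 0 ≤ ∏ j ∈ Finset.univ.erase i, bary s j x :=
    Finset.prod_nonneg fun j _ => bary_nonneg s hx j
  have h1 := hM i x hx
  rw [val_normalPart] at h1
  simp only [smul_apply, innerSL_apply_apply, smul_eq_mul, abs_mul, abs_neg,
    abs_of_nonneg hP, abs_of_pos (hh i)]
  calc _ ≤ (∏ j ∈ Finset.univ.erase i, bary s j x) * ((s.height i)⁻¹ * (M i * bary s i x)) := by
        have := hh i
        gcongr
    _ = (s.height i)⁻¹ * M i * bubble s x := by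
        rw [bubble, ← Finset.mul_prod_erase _ _ (Finset.mem_univ i)]; ring

/-- A cutoff of the bubble function, extended by zero, is differentiable everywhere: it already
vanishes where the bubble function is small, hence near the boundary. -/
lemma hasFDerivAt_indicator_cutoff {ψ : ℝ → ℝ} (hψ : Differentiable ℝ ψ)
    (hψ0 : ∀ t < 1, ψ t = 0) (n : ℕ) (x : EuclideanSpace ℝ (Fin d)) :
    HasFDerivAt ((interior (cell s)).indicator fun y => ψ (n * bubble s y))
      ((interior (cell s)).indicator (fun y => (n * deriv ψ (n * bubble s y)) • bubbleDeriv s y) x)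
      x := by
  by_cases hx : x ∈ interior (cell s)
  · rw [Set.indicator_of_mem hx]
    have h1 : HasFDerivAt (fun y => ψ (n * bubble s y))
        ((n * deriv ψ (n * bubble s x)) • bubbleDeriv s x) x := by
      have := (hψ (n * bubble s x)).hasDerivAt.comp_hasFDerivAt x
        ((hasFDerivAt_bubble s x).const_mul (n : ℝ))
      rwa [smul_smul, mul_comm] at this
    refine h1.congr_of_eventuallyEq ?_
    filter_upwards [isOpen_interior.mem_nhds hx] with y hy
    exact Set.indicator_of_mem hy _
  · rw [Set.indicator_of_notMem hx]
    refine (hasFDerivAt_const (0 : ℝ) x).congr_of_eventuallyEq ?_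
    by_cases hxc : x ∈ cell s
    · have h0 := bubble_eq_zero s hxc hx
      have hlt : ∀ᶠ y in 𝓝 x, n * bubble s y < 1 := by
        have : Continuous fun y => n * bubble s y := by fun_prop
        refine this.continuousAt.eventually (gt_mem_nhds ?_)
        simp [h0]
      filter_upwards [hlt] with y hy
      exact Set.indicator_apply_eq_zero.2 fun _ => hψ0 _ hy
    · filter_upwards [(isCompact_cell s).isClosed.isOpen_compl.mem_nhds hxc] with y hy
      exact Set.indicator_of_notMem (fun h => hy (interior_subset h)) _

/-- The divergence theorem on the interior, for a field multiplied by a cutoff. -/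
lemma integral_cutoff_div {ψ : ℝ → ℝ} (hψ : ContDiff ℝ 1 ψ) (hψ0 : ∀ t < 1, ψ t = 0) (n : ℕ)
    (V : Fin d → MvPolynomial (Fin d) ℝ) :
    ∫ x in interior (cell s), ψ (n * bubble s x) * val (∑ j, MvPolynomial.pderiv j (V j)) x
      = -∫ x in interior (cell s), (n * deriv ψ (n * bubble s x)) *
        bubbleDeriv s x (WithLp.toLp 2 fun j => val (V j) x) := by
  set U := interior (cell s)
  have hU : MeasurableSet U := isOpen_interior.measurableSet
  have hint : ∀ {f : EuclideanSpace ℝ (Fin d) → ℝ}, Continuous f → IntegrableOn f U :=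
    fun hf => (integrableOn_cell s hf).mono_set interior_subset
  have hψc : Continuous ψ := hψ.continuous
  have hψc' : Continuous (deriv ψ) := hψ.continuous_deriv le_rfl
  have hbV : ∀ x, bubbleDeriv s x (WithLp.toLp 2 fun j => val (V j) x)
      = ∑ j, bubbleDeriv s x (EuclideanSpace.single j 1) * val (V j) x := by
    intro x
    have : WithLp.toLp 2 (fun j => val (V j) x)
        = ∑ j, val (V j) x • EuclideanSpace.single j (1 : ℝ) := by
      ext k
      simp [Pi.single_apply]
    rw [this, map_sum]
    exact Finset.sum_congr rfl fun j _ => by rw [map_smul, smul_eq_mul, mul_comm]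
  have hpart : ∀ j, ∫ x in U, ψ (n * bubble s x) * val (MvPolynomial.pderiv j (V j)) x
      = -∫ x in U, (n * deriv ψ (n * bubble s x)) *
        (bubbleDeriv s x (EuclideanSpace.single j 1) * val (V j) x) := by
    intro j
    set Φ := U.indicator fun y => ψ (n * bubble s y)
    have hfΦ : ∀ x, fderiv ℝ Φ x (EuclideanSpace.single j 1) * val (V j) x
        = U.indicator (fun x => (n * deriv ψ (n * bubble s x)) *
        (bubbleDeriv s x (EuclideanSpace.single j 1) * val (V j) x)) x := by
      intro x
      rw [(hasFDerivAt_indicator_cutoff s (hψ.differentiable one_ne_zero) hψ0 n x).fderiv]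
      by_cases hx : x ∈ U
      · rw [Set.indicator_of_mem hx, Set.indicator_of_mem hx]
        simp [mul_assoc]
      · rw [Set.indicator_of_notMem hx, Set.indicator_of_notMem hx]
        simp
    have hfV : ∀ x, fderiv ℝ (val (V j)) x (EuclideanSpace.single j 1)
        = val (MvPolynomial.pderiv j (V j)) x := by
      intro x
      rw [(hasFDerivAt_val (V j) x).fderiv]
      simp
    have hΦV : ∀ x, Φ x * fderiv ℝ (val (V j)) x (EuclideanSpace.single j 1)
        = U.indicator (fun x => ψ (n * bubble s x) * val (MvPolynomial.pderiv j (V j)) x) x := by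
      intro x
      rw [hfV, Set.indicator_mul_left]
    have hΦg : ∀ x, Φ x * val (V j) x
        = U.indicator (fun x => ψ (n * bubble s x) * val (V j) x) x := by
      intro x
      rw [Set.indicator_mul_left]
    have h := integral_mul_fderiv_eq_neg_fderiv_mul_of_integrable (μ := volume) (𝕜 := ℝ)
      (f := Φ) (g := val (V j)) (v := EuclideanSpace.single j 1)
      (by
        simp_rw [hfΦ]
        exact (integrable_indicator_iff hU).2 (hint (by fun_prop)))
      (by
        simp_rw [hΦV]
        exact (integrable_indicator_iff hU).2 (hint (by fun_prop)))
      (by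
        simp_rw [hΦg]
        exact (integrable_indicator_iff hU).2 (hint (by fun_prop)))
      (fun x _ => (hasFDerivAt_indicator_cutoff s (hψ.differentiable one_ne_zero) hψ0 n
        x).differentiableAt)
      (fun x _ => (hasFDerivAt_val (V j) x).differentiableAt)
    simp_rw [hΦV, hfΦ] at h
    rwa [integral_indicator hU, integral_indicator hU] at h
  simp_rw [hbV, val_sum, Finset.mul_sum]
  rw [integral_finsetSum _ fun j _ => hint (by fun_prop),
    integral_finsetSum _ fun j _ => hint (by fun_prop), ← Finset.sum_neg_distrib]
  exact Finset.sum_congr rfl fun j _ => hpart j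

/-- The divergence theorem for a field whose normal component vanishes on the boundary. With the
bubble function `b` and the cutoffs `ψ (n * b)`, the error term is `n ψ'(n b) ∂b`, where `∂b` is the
derivative along the field. It is bounded, as `∂b` is at most a multiple of `b` and `t ψ'(t)` is
bounded, and it tends to zero at every interior point. -/
lemma cellInt_div_eq_zero {V : Fin d → MvPolynomial (Fin d) ℝ}
    (hV : ∀ i, ∀ x ∈ face s i, val (normalPart s i V) x = 0) :
    cellInt s (∑ j, MvPolynomial.pderiv j (V j)) = 0 := by
  obtain ⟨ψ, K, hψ, hψ0, hψ1, hψb, hψK, hψ'⟩ := exists_cutoff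
  obtain ⟨M, hM0, hM⟩ := exists_bubbleDeriv_le s hV
  set p := ∑ j, MvPolynomial.pderiv j (V j)
  set U := interior (cell s)
  have hU : MeasurableSet U := isOpen_interior.measurableSet
  have hψc : Continuous ψ := hψ.continuous
  have hψc' : Continuous (deriv ψ) := hψ.continuous_deriv le_rfl
  have hae : U =ᵐ[volume] cell s :=
    interior_ae_eq_of_null_frontier ((convex_cell s).addHaar_frontier volume)
  have hlarge : ∀ x ∈ U, ∀ᶠ n : ℕ in atTop, 2 < n * bubble s x := fun x hx =>
    (tendsto_natCast_atTop_atTop.atTop_mul_const (bubble_pos s hx)).eventually_gt_atTop 2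
  have hlim1 : Tendsto (fun n : ℕ => ∫ x in U, ψ (n * bubble s x) * val p x) atTop
      (𝓝 (∫ x in U, val p x)) := by
    refine tendsto_integral_of_dominated_convergence (fun x => |val p x|)
      (fun n => (by fun_prop : Continuous fun x => ψ (n * bubble s x) * val p x).aestronglyMeasurable)
      ((integrableOn_cell_val s p).mono_set interior_subset).abs
      (fun n => Eventually.of_forall fun x => ?_) (ae_restrict_of_forall_mem hU fun x hx => ?_)
    · rw [Real.norm_eq_abs, abs_mul]
      exact mul_le_of_le_one_left (abs_nonneg _) (hψb _)
    · refine tendsto_const_nhds.congr' ?_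
      filter_upwards [hlarge x hx] with n hn
      rw [hψ1 _ hn.le, one_mul]
  have hVc : Continuous fun x => (WithLp.toLp 2 fun j => val (V j) x : EuclideanSpace ℝ (Fin d)) :=
    (PiLp.continuous_toLp 2 _).comp (continuous_pi fun j => continuous_val (V j))
  have hlim2 : Tendsto (fun n : ℕ => ∫ x in U, (n * deriv ψ (n * bubble s x)) *
        bubbleDeriv s x (WithLp.toLp 2 fun j => val (V j) x)) atTop (𝓝 (∫ x in U, (0 : ℝ))) := by
    refine tendsto_integral_of_dominated_convergence (fun _ => K * M)
      (fun n => Continuous.aestronglyMeasurable (by fun_prop))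
      ((integrableOn_cell s continuous_const).mono_set interior_subset)
      (fun n => ae_restrict_of_forall_mem hU fun x hx => ?_)
      (ae_restrict_of_forall_mem hU fun x hx => ?_)
    · have hb := bubble_pos s hx
      have h1 := hψK (n * bubble s x) (by positivity)
      rw [Real.norm_eq_abs, abs_mul]
      calc _ ≤ |n * deriv ψ (n * bubble s x)| * (M * bubble s x) :=
            mul_le_mul_of_nonneg_left (hM x (interior_subset hx)) (abs_nonneg _)
        _ = |n * bubble s x * deriv ψ (n * bubble s x)| * M := by
            rw [abs_mul, abs_mul, abs_mul, abs_of_pos hb]; ring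
        _ ≤ K * M := mul_le_mul_of_nonneg_right h1 hM0
    · refine tendsto_const_nhds.congr' ?_
      filter_upwards [hlarge x hx] with n hn
      rw [hψ' _ hn, mul_zero, zero_mul]
  have h := tendsto_nhds_unique (hlim1.congr fun n => integral_cutoff_div s hψ hψ0 n V) hlim2.neg
  rw [integral_zero, neg_zero, setIntegral_congr_set hae] at h
  exact h

end Divergence

/-! ### Non-constant null vectors of the central gradient -/

section Central

variable {d : ℕ} [NeZero d] (s : Affine.Simplex ℝ (EuclideanSpace ℝ (Fin d)) d)

/-- A polynomial that is orthogonal to all polynomials of lower degree has a gradient orthogonal to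
every field of the same degree whose normal component vanishes on the boundary. -/
lemma innerCell_grad_eq_zero {N : ℕ} {u : MvPolynomial (Fin d) ℝ}
    (hu : ∀ q ∈ P d (N - 1), cellInt s (u * q) = 0) {w : Fin d → MvPolynomial (Fin d) ℝ}
    (hw : ∀ j, w j ∈ P d N) (hwn : ∀ i, ∀ x ∈ face s i, val (normalPart s i w) x = 0) :
    innerCell s (grad u) w = 0 := by
  have hdiv := cellInt_div_eq_zero s (V := fun j => u * w j) fun i x hx => by
    have : normalPart s i (fun j => u * w j) = u * normalPart s i w := by
      simp [normalPart_apply, Finset.mul_sum]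
    rw [this, val_mul, hwn i x hx, mul_zero]
  have hq := hu (∑ j, MvPolynomial.pderiv j (w j))
    (Submodule.sum_mem _ fun j _ => pderiv_mem_P j (hw j))
  simp only [MvPolynomial.pderiv_mul, Finset.sum_add_distrib, map_add, ← Finset.mul_sum] at hdiv
  rw [hq, add_zero] at hdiv
  rw [innerCell_eq]
  exact hdiv

/-- There is a non-constant polynomial of degree at most `N` that is orthogonal to all polynomials
of lower degree. -/
lemma exists_orthogonal {N : ℕ} (hN : 1 ≤ N) : ∃ u ∈ P d N,
    (¬ ∃ c : ℝ, u = MvPolynomial.C c) ∧ ∀ q ∈ P d (N - 1), cellInt s (u * q) = 0 := by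
  let T : P d N →ₗ[ℝ] Module.Dual ℝ (P d (N - 1)) :=
    ((LinearMap.mul ℝ (MvPolynomial (Fin d) ℝ)).compr₂ (cellInt s)).domRestrict₁₂ _ _
  have hlt : P d (N - 1) < P d N := by
    refine lt_of_le_of_ne (P_mono (Nat.sub_le N 1)) fun h => ?_
    have h1 : (MvPolynomial.X 0 ^ N : MvPolynomial (Fin d) ℝ) ∈ P d N := by
      rw [MvPolynomial.mem_restrictTotalDegree, MvPolynomial.totalDegree_X_pow]
    rw [← h, MvPolynomial.mem_restrictTotalDegree, MvPolynomial.totalDegree_X_pow] at h1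
    omega
  have hker : LinearMap.ker T ≠ ⊥ := by
    apply LinearMap.ker_ne_bot_of_finrank_lt
    rw [Subspace.dual_finrank_eq]
    exact Submodule.finrank_lt_finrank_of_lt hlt
  obtain ⟨u, hu, hu0⟩ := (Submodule.ne_bot_iff _).1 hker
  have horth : ∀ q ∈ P d (N - 1), cellInt s (u.1 * q) = 0 := fun q hq =>
    LinearMap.congr_fun hu ⟨q, hq⟩
  refine ⟨u, u.2, ?_, horth⟩
  rintro ⟨c, hc⟩
  have h0 := horth u.1 (by rw [hc]; exact C_mem_P _ _)
  exact hu0 (Subtype.ext (eq_zero_of_cellInt_mul_self s h0))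

/-- A functional that vanishes on the fields with zero normal component on the boundary is a
functional of the normal components. -/
lemma exists_face_representation {N : ℕ} (ℓ : (Fin d → MvPolynomial (Fin d) ℝ) →ₗ[ℝ] ℝ)
    (hℓ : ∀ w : Fin d → MvPolynomial (Fin d) ℝ, (∀ j, w j ∈ P d N) →
      (∀ i, ∀ x ∈ face s i, val (normalPart s i w) x = 0) → ℓ w = 0) :
    ∃ g : Fin (d + 1) → MvPolynomial (Fin d) ℝ, (∀ i, g i ∈ P d N) ∧
      ∀ w : Fin d → MvPolynomial (Fin d) ℝ, (∀ j, w j ∈ P d N) →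
        ℓ w = ∑ i, faceInt s i (g i * normalPart s i w) := by
  let G : (Fin (d + 1) → P d N) →ₗ[ℝ] Module.Dual ℝ (Fin d → P d N) :=
    ∑ i, ((LinearMap.mul ℝ (MvPolynomial (Fin d) ℝ)).compr₂ (faceInt s i)).compl₁₂
      ((P d N).subtype ∘ₗ LinearMap.proj i) (normalPart s i ∘ₗ fieldIncl d N)
  have hG : ∀ g w, G g w
      = ∑ i, faceInt s i ((g i : MvPolynomial (Fin d) ℝ) * normalPart s i (fieldIncl d N w)) := by
    intro g w
    simp [G]
  have hmem : ℓ ∘ₗ fieldIncl d N ∈ LinearMap.range G := by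
    rw [← Subspace.dualCoannihilator_dualAnnihilator_eq (W := LinearMap.range G),
      Submodule.mem_dualAnnihilator]
    intro w hw
    refine hℓ _ (fun j => (w j).2) fun i => val_eq_zero_of_faceInt_mul_self s ?_
    -- Test `w` against its own normal component on the face `i`, and zero on the other faces.
    have hi := (Submodule.mem_dualCoannihilator _).1 hw _ ⟨Pi.single i
      ⟨normalPart s i (fieldIncl d N w), normalPart_mem s i fun j => (w j).2⟩, rfl⟩
    rw [hG, Finset.sum_eq_single i, Pi.single_eq_same] at hi
    · exact hi
    · intro k _ hk
      simp [Pi.single_eq_of_ne hk]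
    · simp
  obtain ⟨g, hg⟩ := hmem
  refine ⟨fun i => g i, fun i => (g i).2, fun w hw => ?_⟩
  exact (LinearMap.congr_fun hg fun j => ⟨w j, hw j⟩).symm.trans (hG g fun j => ⟨w j, hw j⟩)

lemma exists_isLDGGradient_zero {N : ℕ} (hN : 1 ≤ N) :
    ∃ u ∈ P d N, (¬ ∃ c : ℝ, u = MvPolynomial.C c) ∧
      ∃ uExt : Fin (d + 1) → MvPolynomial (Fin d) ℝ, (∀ i, uExt i ∈ P d N) ∧
        IsLDGGradient N s 0 u uExt 0 := by
  obtain ⟨u, hu, hc, horth⟩ := exists_orthogonal s hN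
  obtain ⟨g, hg, hgw⟩ := exists_face_representation s (N := N) (cellForm s (grad u))
    fun w hw hwn => innerCell_grad_eq_zero s horth hw hwn
  -- With this exterior value, half the jump is `-g i`.
  refine ⟨u, hu, hc, fun i => u - (2 : ℝ) • g i,
    fun i => Submodule.sub_mem _ hu (Submodule.smul_mem _ _ (hg i)), ⟨fun j => Submodule.zero_mem _,
    fun w hw => ?_⟩⟩
  have h00 : innerCell s 0 w = 0 := LinearMap.map_zero₂ (cellForm s) w
  rw [h00, ← cellForm_apply, hgw w hw, boundaryTerm_eq, ← Finset.sum_add_distrib]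
  refine (Finset.sum_eq_zero fun i _ => ?_).symm
  simp

end Central

end LDG

theorem lemma3 (d : ℕ) [NeZero d] (N : ℕ) :
    -- the LDG gradient is well defined
    (∀ (s : Affine.Simplex ℝ (EuclideanSpace ℝ (Fin d)) d) (β : Fin (d + 1) → ℝ),
      ∀ u ∈ LDG.P d N, ∀ uExt : Fin (d + 1) → MvPolynomial (Fin d) ℝ,
        (∀ i, uExt i ∈ LDG.P d N) →
        ∃! θ : Fin d → MvPolynomial (Fin d) ℝ, LDG.IsLDGGradient N s β u uExt θ) ∧
    -- the estimate, with a constant that depends only on `d`, `N` and the shape regularity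
    (∀ κ : ℝ, ∃ C : ℝ, 0 < C ∧
      ∀ s : Affine.Simplex ℝ (EuclideanSpace ℝ (Fin d)) d, LDG.ShapeRegular κ s →
      ∀ β : Fin (d + 1) → ℝ, (∃ i, β i = 1) →
      ∀ u ∈ LDG.P d N, ∀ uExt : Fin (d + 1) → MvPolynomial (Fin d) ℝ,
        (∀ i, uExt i ∈ LDG.P d N) →
        ∀ θ : Fin d → MvPolynomial (Fin d) ℝ, LDG.IsLDGGradient N s β u uExt θ →
          LDG.normCell s (LDG.grad u) ≤ C * LDG.normCell s θ) ∧
    -- the null space: `u` is a constant, matched by the exterior values wherever they enter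
    (∀ (s : Affine.Simplex ℝ (EuclideanSpace ℝ (Fin d)) d) (β : Fin (d + 1) → ℝ),
      (∃ i, β i = 1) →
      ∀ u ∈ LDG.P d N, ∀ uExt : Fin (d + 1) → MvPolynomial (Fin d) ℝ,
        (∀ i, uExt i ∈ LDG.P d N) →
        (LDG.IsLDGGradient N s β u uExt 0 ↔
          ∃ c : ℝ, u = MvPolynomial.C c ∧
            ∀ i, β i ≠ 1 → ∀ x ∈ LDG.face s i, LDG.val (uExt i) x = c)) ∧
    -- BR-1, that is `β = 0`, has non-constant null vectors on every simplex
    (1 ≤ N → ∀ s : Affine.Simplex ℝ (EuclideanSpace ℝ (Fin d)) d,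
      ∃ u ∈ LDG.P d N, (¬ ∃ c : ℝ, u = MvPolynomial.C c) ∧
        ∃ uExt : Fin (d + 1) → MvPolynomial (Fin d) ℝ, (∀ i, uExt i ∈ LDG.P d N) ∧
          LDG.IsLDGGradient N s 0 u uExt 0) := by
  refine ⟨fun s β u _ uExt _ => LDG.existsUnique_isLDGGradient s N β u uExt, fun κ => ?_,
    fun s β hβ u hu uExt huExt => LDG.isLDGGradient_zero_iff s hβ hu huExt,
    fun hN s => LDG.exists_isLDGGradient_zero s hN⟩
  obtain ⟨C, hC, h⟩ := LDG.exists_normCell_grad_le d N κ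
  exact ⟨C, hC, fun s hs β hβ u hu uExt _ θ hθ => h s hs β hβ u hu uExt θ hθ⟩
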